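/- Let $\mu,\omega>0$. Consider the planar Hill problem $$\mathcal H=\tfrac12(X+\omega y)^2+\tfrac12(Y-\omega x)^2-\tfrac32\omega^2x^2-\frac{\mu}{\sqrt{x^2+y^2}}$$ in the canonical variables $(\phi,q,\Phi,Q)$, $\Phi>0$, given by $\omega x=2Q+\sqrt{2\omega\Phi}\sin\phi$, $\omega y=\omega q+2\sqrt{2\omega\Phi}\cos\phi$, $X=-\omega q-\sqrt{2\omega\Phi}\cos\phi$, $Y=-Q-\sqrt{2\omega\Phi}\sin\phi$. Put $$B=\sqrt{2\Phi/\omega},\qquad \chi=\frac{q}{2B},\qquad \sigma=\frac{Q}{\omega B},\qquad \rho(\phi,\chi,\sigma)=\sqrt{1+3\cos^2\phi+4\sigma\sin\phi+8\chi\cos\phi+4\sigma^2+4\chi^2},$$ so that $\mathcal H=\omega\Phi-\frac32\omega^2B^2\sigma^2-\frac{\mu}{B}\frac1\rho$, and let $T_n(\phi,\chi,\sigma)$ be the coefficient of $\varepsilon^n$ in the Taylor expansion at $\varepsilon=0$ of $1/\rho(\phi,\varepsilon\chi,\varepsilon^2\sigma)$. Arrange the Hamiltonian as $\mathcal K=\sum_{m\ge0}\frac{\varepsilon^m}{m!}K_{m,0}$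 with $$K_{0,0}=\omega\Phi,\quad K_{m,0}=0\ (0<m<4),\quad K_{4,0}=-4!\Big(\tfrac32\omega^2B^2\sigma^2+\frac{\mu}{B}T_0\Big),\quad K_{m,0}=-m!\,\frac{\mu}{B}\,T_{m-4}\ (m>4).$$ Let $\{F;G\}=\partial_\phi F\,\partial_\Phi G-\partial_\Phi F\,\partial_\phi G+\partial_qF\,\partial_QG-\partial_QF\,\partial_qG$. For a generating function $\sum_{m\ge0}\frac{\varepsilon^m}{m!}W_{m+1}$ define the Lie transform of $\mathcal K$ by Deprit's recursion $$K_{n,k+1}=K_{n+1,k}+\sum_{j=0}^{n}\binom nj\{K_{n-j,k};W_{j+1}\}.$$ The normalization is the one in which, successively for $m=1,2,\dots$, $W_m$ is the solution, $2\pi$-periodic in $\phi$ and of zero average over $\phi$, of $\omega\,\partial_\phi W_m=\tilde K_{0,m}-\langle\tilde K_{0,m}\rangle_\phi$, where $\tilde K_{0,m}$ is the part of $K_{0,m}$ that does not involve $W_m$ and $\langle\cdot\rangle_\phi$ is the average over $\phi\in[0,2\pi]$. The new (prime) variables are written below without the prime. Let $\tilde K=\frac1\pi\int_0^{\pi/2}\frac{d\theta}{\sqrt{1-\frac34\sin^2\theta}}$,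 $\tilde E=\frac1\pi\int_0^{\pi/2}\sqrt{1-\tfrac34\sin^2\theta}\,d\theta$, $\Omega=\sqrt{(\tilde K-\tilde E)\mu/B^3}$, and $$b_1=1-\frac{2}{\tilde K-\tilde E}\Big(\tilde K+\frac{\tilde K^2-1/2}{\tilde K-\tilde E}\frac{\Omega^2}{\omega^2}\Big)\frac{\Omega^2}{\omega^2},\qquad b_2=3\Big(1+\frac49\,\frac{4\tilde E-\tilde K}{\tilde K-\tilde E}\frac{\Omega^2}{\omega^2}\Big),$$ $$b_3=\frac23\frac{\Omega^2}{\omega^2},\qquad b_4=\frac19\,\frac{11\tilde K-14\tilde E}{\tilde K-\tilde E}\frac{\Omega^2}{\omega^2}.$$ Then, for all $\Phi>0$ and all $\phi,q,Q$: 1. $K_{0,m}$ does not depend on $\phi$ for $0\le m\le 9$. 2. The normalized Hamiltonian through order eight (at $\varepsilon=1$) is $$\mathcal K'=\sum_{m=0}^{8}\frac{1}{m!}K_{0,m}=\omega\Phi\,(b_1-b_2\sigma^2-2b_3\chi^2-b_4\chi^4).$$ 3. $b_2>0$, $b_3>0$ and $b_4>0$. 4. With $r_\mp=(\tilde K-\tilde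 E)\dfrac{\tilde K\mp\sqrt{3\tilde K^2-1}}{1-2\tilde K^2}$: $b_1=0$ if and only if $\Omega^2/\omega^2\in\{r_-,r_+\}$; $b_1>0$ whenever $\Omega^2/\omega^2<r_-$; $b_1<0$ whenever $r_-<\Omega^2/\omega^2<r_+$; and $|r_--0.226|<0.0005$. 5. The ninth-order term vanishes: $K_{0,9}=0$. -/

import Mathlib

open Real intervalIntegral

noncomputable section

namespace HillDRO

/-- Complete elliptic integral of the first kind, as a function of the parameter `m = k ^ 2`. -/
def ellipticK (m : ℝ) : ℝ := ∫ θ in (0 : ℝ)..(π / 2), 1 / √(1 - m * sin θ ^ 2)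

/-- Complete elliptic integral of the second kind, as a function of the parameter `m = k ^ 2`. -/
def ellipticE (m : ℝ) : ℝ := ∫ θ in (0 : ℝ)..(π / 2), √(1 - m * sin θ ^ 2)

/-- `K(3/4) / π`. -/
def Kt : ℝ := ellipticK (3 / 4) / π

/-- `E(3/4) / π`. -/
def Et : ℝ := ellipticE (3 / 4) / π

/-! ### The planar Hill problem in the variables of the reference ellipse -/

/-- Hamiltonian of the planar Hill problem, in the order `x y X Y`. -/
def hillHamiltonian (μ ω x y X Y : ℝ) : ℝ :=
  (X + ω * y) ^ 2 / 2 + (Y - ω * x) ^ 2 / 2 - 3 / 2 * ω ^ 2 * x ^ 2 - μ / √(x ^ 2 + y ^ 2)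

/-- Semi-minor axis `B` of the reference ellipse. -/
def semiminor (ω Φ : ℝ) : ℝ := √(2 * Φ / ω)

/-- `χ = q / A`, where `A = 2 * B` is the semi-major axis. -/
def chi (ω q Φ : ℝ) : ℝ := q / (2 * semiminor ω Φ)

/-- `σ = (Q / ω) / B`. -/
def sigma (ω Φ Q : ℝ) : ℝ := Q / ω / semiminor ω Φ

/-- The scaled distance `ρ = r / B`. -/
def rho (φ χ σ : ℝ) : ℝ :=
  √(1 + 3 * cos φ ^ 2 + 4 * σ * sin φ + 8 * χ * cos φ + 4 * σ ^ 2 + 4 * χ ^ 2)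

/-- The Hill Hamiltonian in the canonical variables `(φ, q, Φ, Q)` that reduce its quadratic
part; this is the function that `arrangement` splits into orders. -/
theorem hillHamiltonian_reduced (μ ω φ q Φ Q : ℝ) (hω : 0 < ω) (hΦ : 0 < Φ) :
    hillHamiltonian μ ω
      ((2 * Q + √(2 * ω * Φ) * sin φ) / ω)
      ((ω * q + 2 * √(2 * ω * Φ) * cos φ) / ω)
      (-(ω * q) - √(2 * ω * Φ) * cos φ)
      (-Q - √(2 * ω * Φ) * sin φ)
    = ω * Φ - 3 / 2 * ω ^ 2 * semiminor ω Φ ^ 2 * sigma ω Φ Q ^ 2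
      - μ / semiminor ω Φ * (1 / rho φ (chi ω q Φ) (sigma ω Φ Q)) := by
  have hB : 0 < semiminor ω Φ := by unfold semiminor; positivity
  have hB2 : ω * semiminor ω Φ ^ 2 = 2 * Φ := by
    unfold semiminor; rw [Real.sq_sqrt (by positivity)]; field_simp
  have hs : √(2 * ω * Φ) = ω * semiminor ω Φ := by
    rw [Real.sqrt_eq_iff_mul_self_eq (by positivity) (by positivity)]
    nlinarith [hB2]
  have hcs := Real.sin_sq_add_cos_sq φ
  have hr : √(((2 * Q + √(2 * ω * Φ) * sin φ) / ω) ^ 2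
      + ((ω * q + 2 * √(2 * ω * Φ) * cos φ) / ω) ^ 2)
      = semiminor ω Φ * rho φ (chi ω q Φ) (sigma ω Φ Q) := by
    unfold rho
    rw [hs]
    conv_rhs => rw [← Real.sqrt_sq hB.le]
    rw [← Real.sqrt_mul (by positivity)]
    congr 1
    unfold chi sigma
    field_simp
    linear_combination 4 * ω ^ 2 * semiminor ω Φ ^ 2 * hcs
  have hσ : ω * semiminor ω Φ * sigma ω Φ Q = Q := by unfold sigma; field_simp
  have h3 : 3 / 2 * ω ^ 2 * semiminor ω Φ ^ 2 * sigma ω Φ Q ^ 2 = 3 / 2 * Q ^ 2 := by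
    linear_combination 3 / 2 * (ω * semiminor ω Φ * sigma ω Φ Q + Q) * hσ
  unfold hillHamiltonian
  rw [hr, hs, h3]
  field_simp
  linear_combination ω * semiminor ω Φ * hB2 + ω ^ 2 * semiminor ω Φ ^ 3 * hcs

/-! ### Arrangement of the perturbation -/

/-- Coefficient of `ε ^ n` in the expansion of `1 / ρ` after the scaling
`χ ↦ ε * χ`, `σ ↦ ε ^ 2 * σ` (so `σ` is of the order of `χ ^ 2`). -/
def invRhoCoeff (n : ℕ) (φ χ σ : ℝ) : ℝ :=
  iteratedDeriv n (fun ε : ℝ => 1 / rho φ (ε * χ) (ε ^ 2 * σ)) 0 / (n.factorial : ℝ)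

/-- Functions on phase space, with arguments in the order `φ q Φ Q`. -/
abbrev PhaseFn : Type := ℝ → ℝ → ℝ → ℝ → ℝ

/-- The terms `K_{m,0}` of the Hamiltonian `∑ ε ^ m / m! * K_{m,0}`. -/
def arrangement (μ ω : ℝ) (m : ℕ) : PhaseFn := fun φ q Φ Q =>
  if m = 0 then ω * Φ
  else if m < 4 then 0
  else if m = 4 then
    -(Nat.factorial 4 : ℝ) * (3 / 2 * ω ^ 2 * semiminor ω Φ ^ 2 * sigma ω Φ Q ^ 2
      + μ / semiminor ω Φ * invRhoCoeff 0 φ (chi ω q Φ) (sigma ω Φ Q))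
  else
    -(m.factorial : ℝ) * (μ / semiminor ω Φ)
      * invRhoCoeff (m - 4) φ (chi ω q Φ) (sigma ω Φ Q)

/-! ### Normalization by Lie transforms -/

/-- Poisson bracket for the conjugate pairs `(φ, Φ)` and `(q, Q)`. -/
def poisson (F G : PhaseFn) : PhaseFn := fun φ q Φ Q =>
  deriv (fun t => F t q Φ Q) φ * deriv (fun t => G φ q t Q) Φ
    - deriv (fun t => F φ q t Q) Φ * deriv (fun t => G t q Φ Q) φ
    + deriv (fun t => F φ t Φ Q) q * deriv (fun t => G φ q Φ t) Q
    - deriv (fun t => F φ q Φ t) Q * deriv (fun t => G φ t Φ Q) q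

/-- Deprit's triangle for the generating function `∑ ε ^ m / m! * W (m + 1)` and the function
`∑ ε ^ n / n! * F n`. The transformed function is `∑ ε ^ m / m! * depritTriangle W F 0 m`. -/
def depritTriangle (W F : ℕ → PhaseFn) : ℕ → ℕ → PhaseFn
  | n, 0 => F n
  | n, k + 1 => fun φ q Φ Q =>
      depritTriangle W F (n + 1) k φ q Φ Q
        + ∑ j ∈ Finset.range (n + 1),
            (n.choose j : ℝ) * poisson (depritTriangle W F (n - j) k) (W (j + 1)) φ q Φ Q

/-- Average over the angle `φ`. -/
def average (F : PhaseFn) : ℝ → ℝ → ℝ → ℝ := fun q Φ Q =>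
  (1 / (2 * π)) * ∫ t in (0 : ℝ)..(2 * π), F t q Φ Q

/-- Primitive in `φ`, vanishing at `φ = 0`, of the zero-average part of `F`. -/
def periodicPrimitive (F : PhaseFn) : PhaseFn := fun φ q Φ Q =>
  ∫ t in (0 : ℝ)..φ, (F t q Φ Q - average F q Φ Q)

/-- The zero-average solution `W` of the homological equation `ω * ∂W/∂φ = F - average F`. -/
def homologicalSolution (ω : ℝ) (F : PhaseFn) : PhaseFn := fun φ q Φ Q =>
  (1 / ω) * (periodicPrimitive F φ q Φ Q - average (periodicPrimitive F) q Φ Q)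

/-- The generating function truncated after its `m`-th term. With the `(m + 1)`-st term set to
zero, entry `(0, m + 1)` of the triangle is the known part of the `(m + 1)`-st order homological
equation `K_{0,m+1} = known + {K_{0,0}; W_{m+1}}`, whose bracket is `-ω * ∂W_{m+1}/∂φ`. -/
def generatorUpTo (μ ω : ℝ) : ℕ → ℕ → PhaseFn
  | 0 => fun _ _ _ _ _ => 0
  | m + 1 => Function.update (generatorUpTo μ ω m) (m + 1)
      (homologicalSolution ω (depritTriangle (generatorUpTo μ ω m) (arrangement μ ω) 0 (m + 1)))

/-- The terms `W_m` of the generating function of the normalization. -/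
def generator (μ ω : ℝ) (m : ℕ) : PhaseFn := generatorUpTo μ ω m m

/-- The terms `K_{0,m}` of the normalized Hamiltonian `∑ ε ^ m / m! * K_{0,m}`. -/
def normalizedTerm (μ ω : ℝ) (m : ℕ) : PhaseFn :=
  depritTriangle (generator μ ω) (arrangement μ ω) 0 m

/-- The normalized Hamiltonian through order `M`, at `ε = 1`. -/
def normalizedHamiltonian (μ ω : ℝ) (M : ℕ) : PhaseFn := fun φ q Φ Q =>
  ∑ m ∈ Finset.range (M + 1), (1 / (m.factorial : ℝ)) * normalizedTerm μ ω m φ q Φ Q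

/-! ### Coefficients of the normalized Hamiltonian -/

/-- The libration frequency. -/
def librationFreq (μ ω Φ : ℝ) : ℝ := √((Kt - Et) * (μ / semiminor ω Φ ^ 3))

/-- The ratio `Ω ^ 2 / ω ^ 2`. -/
def freqRatio (μ ω Φ : ℝ) : ℝ := librationFreq μ ω Φ ^ 2 / ω ^ 2

def b1 (μ ω Φ : ℝ) : ℝ :=
  1 - 2 / (Kt - Et) * (Kt + (Kt ^ 2 - 1 / 2) / (Kt - Et) * freqRatio μ ω Φ) * freqRatio μ ω Φ

def b2 (μ ω Φ : ℝ) : ℝ :=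
  3 * (1 + 4 / 9 * ((4 * Et - Kt) / (Kt - Et)) * freqRatio μ ω Φ)

def b3 (μ ω Φ : ℝ) : ℝ := 2 / 3 * freqRatio μ ω Φ

def b4 (μ ω Φ : ℝ) : ℝ :=
  1 / 9 * ((11 * Kt - 14 * Et) / (Kt - Et)) * freqRatio μ ω Φ

/-- The smaller root of `b1 = 0`, as an equation in `Ω ^ 2 / ω ^ 2`. -/
def ratioMinus : ℝ := (Kt - Et) * ((Kt - √(3 * Kt ^ 2 - 1)) / (1 - 2 * Kt ^ 2))

/-- The larger root of `b1 = 0`, as an equation in `Ω ^ 2 / ω ^ 2`. -/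
def ratioPlus : ℝ := (Kt - Et) * ((Kt + √(3 * Kt ^ 2 - 1)) / (1 - 2 * Kt ^ 2))

end HillDRO

end

open HillDRO

/-!
The Lie transform is carried out on the half-space `0 < Φ`, where every object is smooth.

*The triangle.* The perturbation starts at order four, so the homological equations of orders one
to three give `W₁ = W₂ = W₃ = 0`. With these zeros Deprit's triangle collapses
(`depritTriangle_of_lt_eight`, `depritTriangle_eight`, `depritTriangle_nine`): up to order seven
`K_{0,m} = K_{m,0} + {K_{0,0}; W_m}`, order eight adds `35 {K_{4,0} + K_{0,4}; W₄}`, and order nine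
adds brackets of `K_{5,0}`, `K_{0,5}` with `W₄` and of `K_{4,0}`, `K_{0,4}` with `W₅`. Since
`{K_{0,0}; W} = -ω ∂W/∂φ`, solving the homological equation replaces the known part of each order
by its average over the angle (`normalizedTerm_eq_average`).

*The averages.* The Taylor coefficients of `1 / ρ` are polynomials in `sin φ`, `cos φ`, `χ`, `σ`
and `r = (1 + 3 cos² φ) ^ (-1 / 2)` (`invRhoCoeff_eq`). Those of odd order have mean zero by the
reflection `φ ↦ π - φ`, `χ ↦ -χ`. Those of orders two and four are, up to exact derivatives
(`circleMean_reduction`) and terms odd under `φ ↦ φ + π`, combinations of `r` and `1 / r`, whose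
means are `K̃` and `4 Ẽ`. At order eight the brackets contribute the variance
`⟨r²⟩ - ⟨r⟩² = 1 / 2 - K̃²` after an integration by parts; at order nine they are odd under
`φ ↦ φ + π`, because `W₄` is proportional to the `π`-periodic primitive of `r - K̃` and `W₅` to
`sin φ r`.

*The signs.* `b1` is a quadratic polynomial in `Ω² / ω²` with roots `ratioMinus` and `ratioPlus`
and positive leading coefficient, and `ratioMinus = (K̃ - Ẽ) / (K̃ + √(3 K̃² - 1))`. What
remains are the numerical bounds `0.686 ≤ K̃ ≤ 0.6866` and `0.38534 ≤ Ẽ ≤ 0.3856`.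
They come from one approximation `b` of `r`,
quadratic in `sin² φ`, refined to polynomial lower and upper bounds of `r` by truncated binomial
series in `1 - b² / r²` (`newton_bounds`); the means of even powers of `sin` are rational.
-/

noncomputable section

namespace HillDRO

/-! ### Taylor coefficients of the inverse distance -/

lemma deriv_quartic (a b c d e : ℝ) :
    deriv (fun x : ℝ => a + b * x + c * x ^ 2 + d * x ^ 3 + e * x ^ 4)
      = fun x : ℝ => b + (2 * c) * x + (3 * d) * x ^ 2 + (4 * e) * x ^ 3 + 0 * x ^ 4 := by
  funext x
  have h : HasDerivAt (fun x : ℝ => a + b * x + c * x ^ 2 + d * x ^ 3 + e * x ^ 4)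
      (b * 1 + c * (2 * x ^ 1 * 1) + d * (3 * x ^ 2 * 1) + e * (4 * x ^ 3 * 1)) x :=
    (((((hasDerivAt_id x).const_mul b).const_add a).add
      (((hasDerivAt_id x).pow 2).const_mul c)).add
      (((hasDerivAt_id x).pow 3).const_mul d)).add (((hasDerivAt_id x).pow 4).const_mul e)
  rw [h.deriv]; ring

/-- Taylor coefficients at `0` of `g = 1 / √p` for a quartic polynomial `p` without cubic term. The
Leibniz rule applied to `g * g * p = 1` determines them successively. -/
lemma iteratedDeriv_inv_sqrt_quartic (p₀ p₁ p₂ p₄ : ℝ) (hp : 0 < p₀) :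
    let d : ℕ → ℝ := fun n => iteratedDeriv n
      (fun x : ℝ => 1 / √(p₀ + p₁ * x + p₂ * x ^ 2 + 0 * x ^ 3 + p₄ * x ^ 4)) 0
    let r : ℝ := 1 / √p₀
    d 0 = r ∧
    d 1 = -(1 / 2) * p₁ * r ^ 3 ∧
    d 2 / 2 = -(1 / 2) * p₂ * r ^ 3 + 3 / 8 * p₁ ^ 2 * r ^ 5 ∧
    d 3 / 6 = 3 / 4 * p₁ * p₂ * r ^ 5 - 5 / 16 * p₁ ^ 3 * r ^ 7 ∧
    d 4 / 24 = -(1 / 2) * p₄ * r ^ 3 + 3 / 8 * p₂ ^ 2 * r ^ 5 - 15 / 16 * p₁ ^ 2 * p₂ * r ^ 7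
      + 35 / 128 * p₁ ^ 4 * r ^ 9 ∧
    d 5 / 120 = 3 / 4 * p₁ * p₄ * r ^ 5 - 15 / 16 * p₁ * p₂ ^ 2 * r ^ 7
      + 35 / 32 * p₁ ^ 3 * p₂ * r ^ 9 - 63 / 256 * p₁ ^ 5 * r ^ 11 := by
  intro d r
  set P : ℝ → ℝ := fun x => p₀ + p₁ * x + p₂ * x ^ 2 + 0 * x ^ 3 + p₄ * x ^ 4 with hP
  set g : ℝ → ℝ := fun x => 1 / √(P x) with hg
  have hPn : ∀ n : WithTop ℕ∞, ContDiffAt ℝ n P 0 := fun n => by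
    simp only [hP]; fun_prop
  have hP0 : P 0 = p₀ := by simp [hP]
  have hgn : ∀ n : WithTop ℕ∞, ContDiffAt ℝ n g 0 := fun n =>
    contDiffAt_const.div ((hPn n).sqrt (by rw [hP0]; exact hp.ne'))
      (by rw [hP0]; positivity)
  have hr : r ^ 2 * p₀ = 1 := by
    simp only [r]; rw [div_pow, Real.sq_sqrt hp.le]; field_simp
  have hr0 : r ≠ 0 := by simp only [r]; positivity
  have hone : (g * g * P) =ᶠ[nhds 0] fun _ => (1 : ℝ) := by
    have : ∀ᶠ x in nhds (0 : ℝ), 0 < P x :=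
      (hPn 0).continuousAt.eventually_const_lt (by rwa [hP0])
    filter_upwards [this] with x hx
    simp only [Pi.mul_apply, hg]
    field_simp
    rw [Real.sq_sqrt hx.le]
  have e : ∀ n, iteratedDeriv n (g * g * P) 0 = if n = 0 then 1 else 0 := fun n => by
    rw [hone.iteratedDeriv_eq, iteratedDeriv_const]
  have q0 : iteratedDeriv 0 P 0 = p₀ := by simp [hP]
  have q1 : iteratedDeriv 1 P 0 = p₁ := by
    simp only [hP, iteratedDeriv_succ', deriv_quartic, iteratedDeriv_zero]; ring
  have q2 : iteratedDeriv 2 P 0 = 2 * p₂ := by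
    simp only [hP, iteratedDeriv_succ', deriv_quartic, iteratedDeriv_zero]; ring
  have q3 : iteratedDeriv 3 P 0 = 0 := by
    simp only [hP, iteratedDeriv_succ', deriv_quartic, iteratedDeriv_zero]; ring
  have q4 : iteratedDeriv 4 P 0 = 24 * p₄ := by
    simp only [hP, iteratedDeriv_succ', deriv_quartic, iteratedDeriv_zero]; ring
  have q5 : iteratedDeriv 5 P 0 = 0 := by
    simp only [hP, iteratedDeriv_succ', deriv_quartic, iteratedDeriv_zero]; ring
  have d0 : d 0 = r := by simp [d, r]
  have rec' : ∀ n, ∑ i ∈ Finset.range (n + 1), (n.choose i : ℝ)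
      * (∑ j ∈ Finset.range (i + 1), (i.choose j : ℝ) * d j * d (i - j))
      * iteratedDeriv (n - i) P 0 = if n = 0 then 1 else 0 := fun n => by
    have hgg : ContDiffAt ℝ n (g * g) 0 := (hgn n).mul (hgn n)
    rw [← e n, iteratedDeriv_mul hgg (hPn n)]
    refine Finset.sum_congr rfl fun i _ => ?_
    rw [iteratedDeriv_mul (hgn i) (hgn i)]
  have e1 := rec' 1
  have e2 := rec' 2
  have e3 := rec' 3
  have e4 := rec' 4
  have e5 := rec' 5
  clear rec'
  norm_num [Finset.sum_range_succ, q0, q1, q2, q3, q4, q5, d0, Nat.choose] at e1 e2 e3 e4 e5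
  have hp₀ : p₀ = 1 / r ^ 2 := by field_simp; linarith
  clear_value d r
  rw [hp₀] at e1 e2 e3 e4 e5
  have f1 : d 1 = -(1 / 2) * p₁ * r ^ 3 := by
    linear_combination (norm := skip) r / 2 * e1
    field_simp; ring
  rw [f1] at e2 e3 e4 e5
  have f2 : d 2 = 2 * (-(1 / 2) * p₂ * r ^ 3 + 3 / 8 * p₁ ^ 2 * r ^ 5) := by
    linear_combination (norm := skip) r / 2 * e2
    field_simp; ring
  rw [f2] at e3 e4 e5
  have f3 : d 3 = 6 * (3 / 4 * p₁ * p₂ * r ^ 5 - 5 / 16 * p₁ ^ 3 * r ^ 7) := by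
    linear_combination (norm := skip) r / 2 * e3
    field_simp; ring
  rw [f3] at e4 e5
  have f4 : d 4 = 24 * (-(1 / 2) * p₄ * r ^ 3 + 3 / 8 * p₂ ^ 2 * r ^ 5
      - 15 / 16 * p₁ ^ 2 * p₂ * r ^ 7 + 35 / 128 * p₁ ^ 4 * r ^ 9) := by
    linear_combination (norm := skip) r / 2 * e4
    field_simp; ring
  rw [f4] at e5
  have f5 : d 5 = 120 * (3 / 4 * p₁ * p₄ * r ^ 5 - 15 / 16 * p₁ * p₂ ^ 2 * r ^ 7
      + 35 / 32 * p₁ ^ 3 * p₂ * r ^ 9 - 63 / 256 * p₁ ^ 5 * r ^ 11) := by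
    linear_combination (norm := skip) r / 2 * e5
    field_simp; ring
  refine ⟨d0, f1, ?_, ?_, ?_, ?_⟩
  · rw [f2]; ring
  · rw [f3]; ring
  · rw [f4]; ring
  · rw [f5]; ring

/-- `1 / ρ` on the reference ellipse, `χ = σ = 0`. -/
def invDist (φ : ℝ) : ℝ := 1 / √(1 + 3 * cos φ ^ 2)

/-- The expansion of `1 / ρ` in `ε` through order five. -/
lemma invRhoCoeff_eq (φ χ σ : ℝ) :
    invRhoCoeff 0 φ χ σ = invDist φ ∧
    invRhoCoeff 1 φ χ σ = -4 * χ * cos φ * invDist φ ^ 3 ∧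
    invRhoCoeff 2 φ χ σ = -2 * (χ ^ 2 + σ * sin φ) * invDist φ ^ 3
      + 24 * χ ^ 2 * cos φ ^ 2 * invDist φ ^ 5 ∧
    invRhoCoeff 3 φ χ σ = 24 * χ * cos φ * (χ ^ 2 + σ * sin φ) * invDist φ ^ 5
      - 160 * χ ^ 3 * cos φ ^ 3 * invDist φ ^ 7 ∧
    invRhoCoeff 4 φ χ σ = -2 * σ ^ 2 * invDist φ ^ 3
      + 6 * (χ ^ 2 + σ * sin φ) ^ 2 * invDist φ ^ 5
      - 240 * χ ^ 2 * cos φ ^ 2 * (χ ^ 2 + σ * sin φ) * invDist φ ^ 7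
      + 1120 * χ ^ 4 * cos φ ^ 4 * invDist φ ^ 9 ∧
    invRhoCoeff 5 φ χ σ = 24 * χ * cos φ * σ ^ 2 * invDist φ ^ 5
      - 120 * χ * cos φ * (χ ^ 2 + σ * sin φ) ^ 2 * invDist φ ^ 7
      + 2240 * χ ^ 3 * cos φ ^ 3 * (χ ^ 2 + σ * sin φ) * invDist φ ^ 9
      - 8064 * χ ^ 5 * cos φ ^ 5 * invDist φ ^ 11 := by
  have hfun : (fun ε : ℝ => 1 / rho φ (ε * χ) (ε ^ 2 * σ)) = fun ε : ℝ =>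
      1 / √(1 + 3 * cos φ ^ 2 + (8 * χ * cos φ) * ε + (4 * χ ^ 2 + 4 * σ * sin φ) * ε ^ 2
        + 0 * ε ^ 3 + (4 * σ ^ 2) * ε ^ 4) := by
    funext ε; unfold rho; congr 2; ring
  obtain ⟨h0, h1, h2, h3, h4, h5⟩ := iteratedDeriv_inv_sqrt_quartic (1 + 3 * cos φ ^ 2)
    (8 * χ * cos φ) (4 * χ ^ 2 + 4 * σ * sin φ) (4 * σ ^ 2) (by positivity)
  unfold invRhoCoeff invDist
  rw [hfun]
  have a0 : ((0 : ℕ).factorial : ℝ) = 1 := by norm_num [Nat.factorial]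
  have a1 : ((1 : ℕ).factorial : ℝ) = 1 := by norm_num [Nat.factorial]
  have a2 : ((2 : ℕ).factorial : ℝ) = 2 := by norm_num [Nat.factorial]
  have a3 : ((3 : ℕ).factorial : ℝ) = 6 := by norm_num [Nat.factorial]
  have a4 : ((4 : ℕ).factorial : ℝ) = 24 := by norm_num [Nat.factorial]
  have a5 : ((5 : ℕ).factorial : ℝ) = 120 := by norm_num [Nat.factorial]
  rw [a0, a1, a2, a3, a4, a5, div_one, div_one]
  refine ⟨h0, h1.trans ?_, h2.trans ?_, h3.trans ?_, h4.trans ?_, h5.trans ?_⟩ <;> ring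

/-! ### Means over the angle -/

/-- The mean of a function over `[0, 2π]`. -/
def circleMean (f : ℝ → ℝ) : ℝ := (1 / (2 * π)) * ∫ t in (0 : ℝ)..(2 * π), f t

lemma average_eq_circleMean (F : PhaseFn) (q Φ Q : ℝ) :
    average F q Φ Q = circleMean fun t => F t q Φ Q := rfl

lemma circleMean_const (a : ℝ) : circleMean (fun _ => a) = a := by
  unfold circleMean
  simp [mul_comm]
  field_simp

lemma circleMean_const_mul (a : ℝ) (f : ℝ → ℝ) :
    circleMean (fun t => a * f t) = a * circleMean f := by
  unfold circleMean
  rw [intervalIntegral.integral_const_mul]; ring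

lemma circleMean_add {f g : ℝ → ℝ} (hf : Continuous f) (hg : Continuous g) :
    circleMean (fun t => f t + g t) = circleMean f + circleMean g := by
  unfold circleMean
  rw [intervalIntegral.integral_add (hf.intervalIntegrable _ _) (hg.intervalIntegrable _ _)]; ring

lemma circleMean_eq_zero_of_hasDerivAt {f G : ℝ → ℝ} (hG : ∀ x, HasDerivAt G (f x) x)
    (hf : Continuous f) (hper : G (2 * π) = G 0) : circleMean f = 0 := by
  unfold circleMean
  rw [intervalIntegral.integral_eq_sub_of_hasDerivAt (fun x _ => hG x)
    (hf.intervalIntegrable _ _), hper, sub_self, mul_zero]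

lemma circleMean_eq_zero_of_add_pi {f : ℝ → ℝ} (hf : ∀ x, f (x + π) = -f x) :
    circleMean f = 0 := by
  have hper : Function.Periodic f (2 * π) := fun x => by
    rw [show x + 2 * π = x + π + π by ring, hf, hf, neg_neg]
  have h := hper.intervalIntegral_add_eq 0 π
  have h2 : ∫ x in (0 : ℝ)..(2 * π), f (x + π) = ∫ x in π..(π + 2 * π), f x := by
    rw [intervalIntegral.integral_comp_add_right]; congr 1 <;> ring
  simp only [hf, intervalIntegral.integral_neg] at h2
  rw [zero_add] at h
  unfold circleMean
  rw [show ∫ x in (0 : ℝ)..(2 * π), f x = 0 by linarith, mul_zero]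

lemma circleMean_eq_zero_of_pi_sub {f : ℝ → ℝ} (hper : Function.Periodic f (2 * π))
    (hf : ∀ x, f (π - x) = -f x) : circleMean f = 0 := by
  have h := hper.intervalIntegral_add_eq 0 (-π)
  have h2 : ∫ x in (0 : ℝ)..(2 * π), f (π - x) = ∫ x in (-π)..(-π + 2 * π), f x := by
    rw [intervalIntegral.integral_comp_sub_left]; congr 1 <;> ring
  simp only [hf, intervalIntegral.integral_neg] at h2
  rw [zero_add] at h
  unfold circleMean
  rw [show ∫ x in (0 : ℝ)..(2 * π), f x = 0 by linarith, mul_zero]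

/-! ### The inverse distance on the reference ellipse -/

lemma invDist_pos (φ : ℝ) : 0 < invDist φ := by unfold invDist; positivity

lemma invDist_sq (φ : ℝ) : invDist φ ^ 2 * (1 + 3 * cos φ ^ 2) = 1 := by
  have h : 0 < 1 + 3 * cos φ ^ 2 := by positivity
  unfold invDist
  rw [div_pow, Real.sq_sqrt h.le]; field_simp

@[fun_prop]
lemma continuous_invDist : Continuous invDist := by
  unfold invDist
  exact continuous_const.div (by fun_prop) fun x => by positivity

lemma invDist_add_pi (φ : ℝ) : invDist (φ + π) = invDist φ := by
  unfold invDist; rw [cos_add_pi, neg_sq]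

lemma invDist_add_two_pi (φ : ℝ) : invDist (φ + 2 * π) = invDist φ := by
  unfold invDist; rw [cos_add_two_pi]

lemma hasDerivAt_invDist (φ : ℝ) :
    HasDerivAt invDist (3 * cos φ * sin φ * invDist φ ^ 3) φ := by
  have h : 0 < 1 + 3 * cos φ ^ 2 := by positivity
  have h1 : HasDerivAt (fun t => 1 + 3 * cos t ^ 2) (3 * (2 * cos φ ^ 1 * -sin φ)) φ :=
    (((hasDerivAt_cos φ).pow 2).const_mul 3).const_add 1
  have h2 := (h1.sqrt h.ne').fun_inv (by positivity)
  have h3 : invDist = fun t => (√(1 + 3 * cos t ^ 2))⁻¹ := by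
    funext t; unfold invDist; rw [one_div]
  refine (h3 ▸ h2).congr_deriv ?_
  unfold invDist
  field_simp

lemma hasDerivAt_invDist_pow (n : ℕ) (φ : ℝ) :
    HasDerivAt (fun t => invDist t ^ n) (n * (3 * cos φ * sin φ) * invDist φ ^ (n + 2)) φ := by
  refine ((hasDerivAt_invDist φ).fun_pow n).congr_deriv ?_
  rcases n with _ | n
  · simp
  · simp only [Nat.add_sub_cancel]; ring

/-- Symmetry of the ellipse reduces a full turn to four quarter turns. -/
lemma circleMean_comp_cos_sq (h : ℝ → ℝ) (hc : Continuous h) :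
    circleMean (fun t => h (cos t ^ 2)) = 2 / π * ∫ θ in (0 : ℝ)..(π / 2), h (cos θ ^ 2) := by
  have hcont : Continuous fun t => h (cos t ^ 2) := by fun_prop
  have I : ∀ a b, IntervalIntegrable (fun t => h (cos t ^ 2)) MeasureTheory.volume a b :=
    fun a b => hcont.intervalIntegrable _ _
  have e1 : ∫ t in (0 : ℝ)..(π / 2), h (cos t ^ 2) = ∫ t in (π / 2)..π, h (cos t ^ 2) := by
    have := intervalIntegral.integral_comp_sub_left (a := (0 : ℝ)) (b := π / 2)
      (fun t => h (cos t ^ 2)) π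
    simp only [cos_pi_sub, neg_sq] at this
    rw [this]; congr 1 <;> ring
  have e2 : ∫ t in (0 : ℝ)..π, h (cos t ^ 2) = ∫ t in π..(2 * π), h (cos t ^ 2) := by
    have := intervalIntegral.integral_comp_add_right (a := (0 : ℝ)) (b := π)
      (fun t => h (cos t ^ 2)) π
    simp only [cos_add_pi, neg_sq] at this
    rw [this]; congr 1 <;> ring
  have e3 := intervalIntegral.integral_add_adjacent_intervals (I 0 (π / 2)) (I (π / 2) π)
  have e4 := intervalIntegral.integral_add_adjacent_intervals (I 0 π) (I π (2 * π))
  unfold circleMean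
  rw [← e4, ← e2, ← e3, ← e1]
  field_simp; ring

lemma one_add_three_cos_sq (θ : ℝ) : 1 + 3 * cos θ ^ 2 = 2 ^ 2 * (1 - 3 / 4 * sin θ ^ 2) := by
  rw [sin_sq]; ring

lemma circleMean_invDist : circleMean invDist = Kt := by
  have hc : Continuous fun u : ℝ => 1 / √(1 + 3 * |u|) :=
    continuous_const.div (by fun_prop) fun x => by positivity
  have h := circleMean_comp_cos_sq _ hc
  have e : (fun t => 1 / √(1 + 3 * |cos t ^ 2|)) = invDist := by
    funext t; unfold invDist; rw [abs_of_nonneg (sq_nonneg _)]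
  rw [e] at h
  unfold Kt ellipticK
  rw [h, show ∀ x : ℝ, 2 / π * x = 2 * x / π by intro x; ring,
    ← intervalIntegral.integral_const_mul]
  congr 1
  refine intervalIntegral.integral_congr fun θ _ => ?_
  unfold invDist
  rw [one_add_three_cos_sq, Real.sqrt_mul (by positivity), Real.sqrt_sq (by norm_num)]
  ring

lemma circleMean_dist : circleMean (fun t => (1 + 3 * cos t ^ 2) * invDist t) = 4 * Et := by
  have h := circleMean_comp_cos_sq (fun u => √(1 + 3 * u)) (by fun_prop)
  have e : (fun t => (1 + 3 * cos t ^ 2) * invDist t) = fun t => √(1 + 3 * cos t ^ 2) := by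
    funext t
    unfold invDist
    rw [mul_one_div, Real.div_sqrt]
  unfold Et ellipticE
  rw [e, h, show ∀ x : ℝ, 2 / π * x = 2 * x / π by intro x; ring, ← mul_div_assoc,
    ← intervalIntegral.integral_const_mul, ← intervalIntegral.integral_const_mul]
  congr 1
  refine intervalIntegral.integral_congr fun θ _ => ?_
  change 2 * √(1 + 3 * cos θ ^ 2) = 4 * _
  rw [one_add_three_cos_sq, Real.sqrt_mul (by positivity), Real.sqrt_sq (by norm_num)]
  ring

/-- The primitive `t / 2 - arctan (sin t cos t / (1 + cos² t)) / 2` of `1 / (1 + 3 cos² t)` is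
the everywhere smooth form of `arctan (tan t / 2) / 2`. -/
lemma circleMean_invDist_sq : circleMean (fun t => invDist t ^ 2) = 1 / 2 := by
  have hG : ∀ x, HasDerivAt (fun t => t / 2 - arctan (sin t * cos t / (1 + cos t ^ 2)) / 2)
      (invDist x ^ 2) x := fun x => by
    have h0 : (1 + cos x ^ 2) ≠ 0 := by positivity
    have h1 : 1 + 3 * cos x ^ 2 ≠ 0 := by positivity
    have hd : HasDerivAt (fun t => 1 + cos t ^ 2) (2 * cos x ^ 1 * -sin x) x :=
      ((hasDerivAt_cos x).pow 2).const_add 1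
    have h := ((hasDerivAt_id x).div_const 2).sub
      (((((hasDerivAt_sin x).fun_mul (hasDerivAt_cos x)).fun_div hd h0).arctan).div_const 2)
    refine h.congr_deriv ?_
    have hr : invDist x ^ 2 = 1 / (1 + 3 * cos x ^ 2) := by
      rw [eq_div_iff h1]; exact invDist_sq x
    rw [hr]
    have hs : sin x ^ 2 = 1 - cos x ^ 2 := sin_sq x
    have h2 : 1 + (sin x * cos x / (1 + cos x ^ 2)) ^ 2
        = (1 + 3 * cos x ^ 2) / (1 + cos x ^ 2) ^ 2 := by
      field_simp
      rw [hs]; ring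
    rw [h2]
    field_simp
    linear_combination (1 - cos x ^ 2) * hs
  unfold circleMean
  rw [intervalIntegral.integral_eq_sub_of_hasDerivAt (fun x _ => hG x)
    ((by fun_prop : Continuous fun t => invDist t ^ 2).intervalIntegrable _ _)]
  simp
  field_simp

/-- The reduction formula: the derivative of `sin t cos t Q(cos² t) r ^ k`, with
`r = invDist t` and `Q` a cubic, has mean zero. -/
lemma circleMean_reduction (k : ℕ) (α β a b c d : ℝ) :
    circleMean (fun t => α * invDist t + β * ((1 + 3 * cos t ^ 2) * invDist t)
      + (((2 * cos t ^ 2 - 1) * (a + b * cos t ^ 2 + c * cos t ^ 4 + d * cos t ^ 6)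
          - 2 * cos t ^ 2 * (1 - cos t ^ 2) * (b + 2 * c * cos t ^ 2 + 3 * d * cos t ^ 4))
            * invDist t ^ k
        + 3 * k * cos t ^ 2 * (1 - cos t ^ 2)
          * (a + b * cos t ^ 2 + c * cos t ^ 4 + d * cos t ^ 6) * invDist t ^ (k + 2)))
      = α * Kt + β * (4 * Et) := by
  have hG : ∀ x, HasDerivAt (fun t => sin t * cos t
        * (a + b * cos t ^ 2 + c * cos t ^ 4 + d * cos t ^ 6) * invDist t ^ k)
      (((2 * cos x ^ 2 - 1) * (a + b * cos x ^ 2 + c * cos x ^ 4 + d * cos x ^ 6)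
          - 2 * cos x ^ 2 * (1 - cos x ^ 2) * (b + 2 * c * cos x ^ 2 + 3 * d * cos x ^ 4))
            * invDist x ^ k
        + 3 * k * cos x ^ 2 * (1 - cos x ^ 2)
          * (a + b * cos x ^ 2 + c * cos x ^ 4 + d * cos x ^ 6) * invDist x ^ (k + 2)) x :=
      fun x => by
    have hs := hasDerivAt_sin x
    have hc := hasDerivAt_cos x
    have h := (((hs.fun_mul hc).fun_mul (((((hc.fun_pow 2).const_mul b).const_add a).fun_add
      ((hc.fun_pow 4).const_mul c)).fun_add ((hc.fun_pow 6).const_mul d))).fun_mul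
      (hasDerivAt_invDist_pow k x))
    refine h.congr_deriv ?_
    rw [← sin_sq x]
    have hs2 : sin x ^ 2 = 1 - cos x ^ 2 := sin_sq x
    push_cast
    linear_combination -(a + b * cos x ^ 2 + c * cos x ^ 4 + d * cos x ^ 6) * invDist x ^ k * hs2
  have h0 := circleMean_eq_zero_of_hasDerivAt hG (by fun_prop) (by simp)
  rw [circleMean_add (by fun_prop) (by fun_prop), h0, circleMean_add (by fun_prop) (by fun_prop),
    circleMean_const_mul, circleMean_const_mul, circleMean_invDist, circleMean_dist, add_zero]

lemma circleMean_invRhoCoeff_two (χ σ : ℝ) :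
    circleMean (fun t => invRhoCoeff 2 t χ σ) = 2 / 3 * (Kt - Et) * χ ^ 2 := by
  have hA : circleMean (fun t => -2 * invDist t ^ 3 + 24 * cos t ^ 2 * invDist t ^ 5)
      = 2 / 3 * (Kt - Et) := by
    -- the constants solve the linear system that expresses the integrand in reduced form
    have h := circleMean_reduction 3 (2 / 3) (-1 / 6) (5 / 2) (3 / 2) 0 0
    rw [show 2 / 3 * (Kt - Et) = 2 / 3 * Kt + -1 / 6 * (4 * Et) by ring, ← h]
    congr 1; funext t
    have hr := invDist_sq t
    set r := invDist t
    set u := cos t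
    have k3 : r ^ 3 = r ^ 5 * (1 + 3 * u ^ 2) := by linear_combination -r ^ 3 * hr
    have k1 : r = r ^ 5 * (1 + 3 * u ^ 2) ^ 2 := by
      linear_combination -r * (1 + r ^ 2 * (1 + 3 * u ^ 2)) * hr
    linear_combination
      (-2 - ((2 * u ^ 2 - 1) * (5 / 2 + 3 / 2 * u ^ 2) - 2 * u ^ 2 * (1 - u ^ 2) * (3 / 2))) * k3
      - (2 / 3 - 1 / 6 * (1 + 3 * u ^ 2)) * k1
  have hB : circleMean (fun t => sin t * invDist t ^ 3) = 0 :=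
    circleMean_eq_zero_of_add_pi fun x => by rw [sin_add_pi, invDist_add_pi]; ring
  have hf : (fun t => invRhoCoeff 2 t χ σ) = fun t =>
      χ ^ 2 * (-2 * invDist t ^ 3 + 24 * cos t ^ 2 * invDist t ^ 5)
      + (-2 * σ) * (sin t * invDist t ^ 3) := by
    funext t; rw [(invRhoCoeff_eq t χ σ).2.2.1]; ring
  rw [hf, circleMean_add (by fun_prop) (by fun_prop), circleMean_const_mul, circleMean_const_mul,
    hA, hB]
  ring

lemma circleMean_invRhoCoeff_four (χ σ : ℝ) :
    circleMean (fun t => invRhoCoeff 4 t χ σ)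
      = (11 * Kt - 14 * Et) / 18 * χ ^ 4 + 2 / 3 * (4 * Et - Kt) * σ ^ 2 := by
  have hC : circleMean (fun t => 6 * invDist t ^ 5 - 240 * cos t ^ 2 * invDist t ^ 7
      + 1120 * cos t ^ 4 * invDist t ^ 9) = (11 * Kt - 14 * Et) / 18 := by
    have h := circleMean_reduction 7 (11 / 18) (-7 / 36) (-67 / 12) (129 / 4) (129 / 4) (63 / 4)
    rw [show (11 * Kt - 14 * Et) / 18 = 11 / 18 * Kt + -7 / 36 * (4 * Et) by ring, ← h]
    congr 1; funext t
    have hr := invDist_sq t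
    set r := invDist t
    set u := cos t
    have k7 : r ^ 7 = r ^ 9 * (1 + 3 * u ^ 2) := by linear_combination -r ^ 7 * hr
    have k5 : r ^ 5 = r ^ 9 * (1 + 3 * u ^ 2) ^ 2 := by
      linear_combination -r ^ 5 * (1 + r ^ 2 * (1 + 3 * u ^ 2)) * hr
    have k1 : r = r ^ 9 * (1 + 3 * u ^ 2) ^ 4 := by
      have : (r ^ 2 * (1 + 3 * u ^ 2)) ^ 4 = 1 := by rw [hr]; norm_num
      linear_combination -r * this
    linear_combination 6 * k5 + (-240 * u ^ 2
        - ((2 * u ^ 2 - 1) * (-67 / 12 + 129 / 4 * u ^ 2 + 129 / 4 * u ^ 4 + 63 / 4 * u ^ 6)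
          - 2 * u ^ 2 * (1 - u ^ 2) * (129 / 4 + 2 * (129 / 4) * u ^ 2 + 3 * (63 / 4) * u ^ 4)))
        * k7
      - (11 / 18 - 7 / 36 * (1 + 3 * u ^ 2)) * k1
  have hD : circleMean (fun t => -2 * invDist t ^ 3 + 6 * sin t ^ 2 * invDist t ^ 5)
      = 2 / 3 * (4 * Et - Kt) := by
    have h := circleMean_reduction 3 (-2 / 3) (2 / 3) (-4) (-6) 0 0
    rw [show 2 / 3 * (4 * Et - Kt) = -2 / 3 * Kt + 2 / 3 * (4 * Et) by ring, ← h]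
    congr 1; funext t
    have hr := invDist_sq t
    rw [sin_sq]
    set r := invDist t
    set u := cos t
    have k3 : r ^ 3 = r ^ 5 * (1 + 3 * u ^ 2) := by linear_combination -r ^ 3 * hr
    have k1 : r = r ^ 5 * (1 + 3 * u ^ 2) ^ 2 := by
      linear_combination -r * (1 + r ^ 2 * (1 + 3 * u ^ 2)) * hr
    linear_combination
      (-2 - ((2 * u ^ 2 - 1) * (-4 - 6 * u ^ 2) - 2 * u ^ 2 * (1 - u ^ 2) * (-6))) * k3
      - (-2 / 3 + 2 / 3 * (1 + 3 * u ^ 2)) * k1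
  have hX : circleMean (fun t => sin t * (12 * invDist t ^ 5 - 240 * cos t ^ 2 * invDist t ^ 7))
      = 0 :=
    circleMean_eq_zero_of_add_pi fun x => by rw [sin_add_pi, cos_add_pi, invDist_add_pi]; ring
  have hf : (fun t => invRhoCoeff 4 t χ σ) = fun t =>
      χ ^ 4 * (6 * invDist t ^ 5 - 240 * cos t ^ 2 * invDist t ^ 7
        + 1120 * cos t ^ 4 * invDist t ^ 9)
      + σ ^ 2 * (-2 * invDist t ^ 3 + 6 * sin t ^ 2 * invDist t ^ 5)
      + (χ ^ 2 * σ) * (sin t * (12 * invDist t ^ 5 - 240 * cos t ^ 2 * invDist t ^ 7)) := by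
    funext t; rw [(invRhoCoeff_eq t χ σ).2.2.2.2.1]; ring
  rw [hf, circleMean_add (by fun_prop) (by fun_prop), circleMean_add (by fun_prop) (by fun_prop),
    circleMean_const_mul, circleMean_const_mul, circleMean_const_mul, hC, hD, hX]
  ring

@[fun_prop]
lemma continuous_invRhoCoeff {n : ℕ} (hn : n ≤ 5) (χ σ : ℝ) :
    Continuous fun t => invRhoCoeff n t χ σ := by
  have h := fun t => invRhoCoeff_eq t χ σ
  interval_cases n
  · simp only [(h _).1]; fun_prop
  · simp only [(h _).2.1]; fun_prop
  · simp only [(h _).2.2.1]; fun_prop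
  · simp only [(h _).2.2.2.1]; fun_prop
  · simp only [(h _).2.2.2.2.1]; fun_prop
  · simp only [(h _).2.2.2.2.2]; fun_prop

/-- The reflection `φ ↦ π - φ`, `χ ↦ -χ` preserves `ρ`, and `χ ↦ -χ` amounts to `ε ↦ -ε`. -/
lemma circleMean_invRhoCoeff_odd {n : ℕ} (hn : Odd n) (χ σ : ℝ) :
    circleMean (fun t => invRhoCoeff n t χ σ) = 0 := by
  refine circleMean_eq_zero_of_pi_sub (fun t => ?_) fun t => ?_
  · simp only [invRhoCoeff, rho, cos_add_two_pi, sin_add_two_pi]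
  · have h := iteratedDeriv_comp_neg n (fun ε : ℝ => 1 / rho t (ε * χ) (ε ^ 2 * σ)) 0
    rw [hn.neg_one_pow, neg_zero, neg_one_smul] at h
    unfold invRhoCoeff
    rw [← neg_div, ← h]
    congr 2
    funext ε
    unfold rho
    rw [cos_pi_sub, sin_pi_sub]
    congr 2; ring

/-! ### Low orders of Deprit's triangle -/

lemma poisson_zero_left (G : PhaseFn) : poisson 0 G = 0 := by
  funext φ q Φ Q; simp [poisson]

lemma poisson_zero_right (F : PhaseFn) : poisson F 0 = 0 := by
  funext φ q Φ Q; simp [poisson]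

lemma depritTriangle_zero (W F : ℕ → PhaseFn) (n : ℕ) : depritTriangle W F n 0 = F n := by
  unfold depritTriangle; rfl

lemma depritTriangle_succ (W F : ℕ → PhaseFn) (n k : ℕ) :
    depritTriangle W F n (k + 1) = depritTriangle W F (n + 1) k
      + ∑ j ∈ Finset.range (n + 1),
          (n.choose j : ℝ) • poisson (depritTriangle W F (n - j) k) (W (j + 1)) := by
  funext φ q Φ Q
  rw [depritTriangle]
  simp [Finset.sum_apply]

section

variable {W F : ℕ → PhaseFn} (hW : ∀ m, 0 < m → m < 4 → W m = 0)
  (hF : ∀ m, 0 < m → m < 4 → F m = 0)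

include hW hF

lemma depritTriangle_eq_zero (k : ℕ) : ∀ n, 0 < n + k → n + k < 4 →
    depritTriangle W F n k = 0 := by
  induction k with
  | zero => intro n h0 h4; rw [depritTriangle_zero, hF n h0 h4]
  | succ k ih =>
    intro n h0 h4
    rw [depritTriangle_succ, ih (n + 1) (by omega) (by omega), zero_add]
    refine Finset.sum_eq_zero fun j hj => ?_
    rw [Finset.mem_range] at hj
    rw [hW (j + 1) (by omega) (by omega), poisson_zero_right, smul_zero]

lemma depritTriangle_of_lt_eight (k : ℕ) : ∀ n, 4 ≤ n + k + 1 → n + k + 1 < 8 →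
    depritTriangle W F n (k + 1) = F (n + k + 1) + poisson (F 0) (W (n + k + 1)) := by
  induction k with
  | zero =>
    intro n h4 h8
    rw [depritTriangle_succ, Finset.sum_range_succ, Finset.sum_eq_zero, zero_add, Nat.sub_self,
      depritTriangle_zero, depritTriangle_zero, Nat.choose_self, Nat.cast_one, one_smul]
    · intro j hj
      rw [Finset.mem_range] at hj
      rcases lt_or_ge (n - j) 4 with h | h
      · rw [depritTriangle_zero, hF (n - j) (by omega) h, poisson_zero_left, smul_zero]
      · rw [hW (j + 1) (by omega) (by omega), poisson_zero_right, smul_zero]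
  | succ k ih =>
    intro n h4 h8
    rw [depritTriangle_succ, ih (n + 1) (by omega) (by omega), Finset.sum_eq_zero, add_zero]
    · rw [show n + 1 + k + 1 = n + (k + 1) + 1 by omega]
    · intro j hj
      rw [Finset.mem_range] at hj
      rcases lt_or_ge (j + 1) 4 with h | h
      · rw [hW (j + 1) (by omega) h, poisson_zero_right, smul_zero]
      · rw [depritTriangle_eq_zero hW hF (k + 1) (n - j) (by omega) (by omega),
          poisson_zero_left, smul_zero]

lemma depritTriangle_eight :
    depritTriangle W F 0 8 = F 8 + poisson (F 0) (W 8) + (35 : ℝ) • poisson (F 4) (W 4)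
      + (35 : ℝ) • poisson (F 4 + poisson (F 0) (W 4)) (W 4) := by
  have z := depritTriangle_eq_zero hW hF
  have t := depritTriangle_of_lt_eight hW hF
  have w1 := hW 1 (by norm_num) (by norm_num)
  have w2 := hW 2 (by norm_num) (by norm_num)
  have w3 := hW 3 (by norm_num) (by norm_num)
  have h7 : depritTriangle W F 7 1
      = F 8 + poisson (F 0) (W 8) + (35 : ℝ) • poisson (F 4) (W 4) := by
    rw [depritTriangle_succ]
    simp [Finset.sum_range_succ, depritTriangle_zero, w1, w2, w3, hF, poisson_zero_left,
      poisson_zero_right, Nat.choose]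
    abel
  have step : ∀ n k, n + k = 6 → depritTriangle W F n (k + 2)
      = depritTriangle W F (n + 1) (k + 1)
        + (n.choose 3 : ℝ) • poisson (F 4 + poisson (F 0) (W 4)) (W 4) := fun n k hnk => by
    rw [depritTriangle_succ, Finset.sum_eq_single 3]
    · rcases lt_or_ge n 3 with h | h
      · rw [Nat.choose_eq_zero_of_lt h]; simp
      · rw [t k (n - 3) (by omega) (by omega), show n - 3 + k + 1 = 4 by omega]
    · intro j hj h3
      rw [Finset.mem_range] at hj
      rcases lt_or_ge j 3 with h | h
      · rw [hW (j + 1) (by omega) (by omega), poisson_zero_right, smul_zero]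
      · rw [z (k + 1) (n - j) (by omega) (by omega), poisson_zero_left, smul_zero]
    · intro h3
      rw [Finset.mem_range] at h3
      rw [Nat.choose_eq_zero_of_lt (by omega)]; simp
  -- `choose 3 3 + choose 4 3 + choose 5 3 + choose 6 3 = 35`
  rw [step 0 6 rfl, step 1 5 rfl, step 2 4 rfl, step 3 3 rfl, step 4 2 rfl, step 5 1 rfl,
    step 6 0 rfl, h7]
  norm_num [Nat.choose]
  module

lemma depritTriangle_nine :
    depritTriangle W F 0 9 = F 9 + poisson (F 0) (W 9)
      + (56 : ℝ) • poisson (F 5) (W 4) + (70 : ℝ) • poisson (F 4) (W 5)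
      + (70 : ℝ) • poisson (F 5 + poisson (F 0) (W 5)) (W 4)
      + (56 : ℝ) • poisson (F 4 + poisson (F 0) (W 4)) (W 5) := by
  have z := depritTriangle_eq_zero hW hF
  have t := depritTriangle_of_lt_eight hW hF
  have w1 := hW 1 (by norm_num) (by norm_num)
  have w2 := hW 2 (by norm_num) (by norm_num)
  have w3 := hW 3 (by norm_num) (by norm_num)
  have h8 : depritTriangle W F 8 1
      = F 9 + poisson (F 0) (W 9) + (56 : ℝ) • poisson (F 5) (W 4)
        + (70 : ℝ) • poisson (F 4) (W 5) := by
    rw [depritTriangle_succ]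
    simp [Finset.sum_range_succ, depritTriangle_zero, w1, w2, w3, hF, poisson_zero_left,
      poisson_zero_right, Nat.choose]
    abel
  have step : ∀ n k, n + k = 7 → depritTriangle W F n (k + 2)
      = depritTriangle W F (n + 1) (k + 1)
        + ((n.choose 3 : ℝ) • poisson (F 5 + poisson (F 0) (W 5)) (W 4)
        + (n.choose 4 : ℝ) • poisson (F 4 + poisson (F 0) (W 4)) (W 5)) := fun n k hnk => by
    rw [depritTriangle_succ, Finset.sum_eq_add 3 4 (by norm_num)]
    · congr 2
      · rcases lt_or_ge n 3 with h | h
        · rw [Nat.choose_eq_zero_of_lt h]; simp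
        · rw [t k (n - 3) (by omega) (by omega), show n - 3 + k + 1 = 5 by omega]
      · rcases lt_or_ge n 4 with h | h
        · rw [Nat.choose_eq_zero_of_lt h]; simp
        · rw [t k (n - 4) (by omega) (by omega), show n - 4 + k + 1 = 4 by omega]
    · intro j hj h3
      rw [Finset.mem_range] at hj
      rcases lt_or_ge j 3 with h | h
      · rw [hW (j + 1) (by omega) (by omega), poisson_zero_right, smul_zero]
      · rw [z (k + 1) (n - j) (by omega) (by omega), poisson_zero_left, smul_zero]
    · intro h3
      rw [Finset.mem_range] at h3
      rw [Nat.choose_eq_zero_of_lt (by omega)]; simp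
    · intro h3
      rw [Finset.mem_range] at h3
      rw [Nat.choose_eq_zero_of_lt (by omega)]; simp
  -- the sums of `choose n 3` and `choose n 4` over `n ≤ 7` are `70` and `56`
  rw [step 0 7 rfl, step 1 6 rfl, step 2 5 rfl, step 3 4 rfl, step 4 3 rfl, step 5 2 rfl,
    step 6 1 rfl, step 7 0 rfl, h8]
  norm_num [Nat.choose]
  module

end

/-! ### The homological equation -/

lemma poisson_arrangement_zero (μ ω : ℝ) (W : PhaseFn) (φ q Φ Q : ℝ) :
    poisson (arrangement μ ω 0) W φ q Φ Q = -(ω * deriv (fun t => W t q Φ Q) φ) := by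
  have h : arrangement μ ω 0 = fun _ _ Φ _ => ω * Φ := by
    funext φ q Φ Q; simp [arrangement]
  have hd : deriv (fun t : ℝ => ω * t) Φ = ω := by simp
  rw [h]
  simp only [poisson, deriv_const, hd]
  ring

lemma hasDerivAt_homologicalSolution {ω : ℝ} {F : PhaseFn} {q Φ Q : ℝ}
    (hF : Continuous fun t => F t q Φ Q) (φ : ℝ) :
    HasDerivAt (fun t => homologicalSolution ω F t q Φ Q)
      (1 / ω * (F φ q Φ Q - average F q Φ Q)) φ := by
  have hc : Continuous fun t => F t q Φ Q - average F q Φ Q := by fun_prop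
  unfold homologicalSolution periodicPrimitive
  exact ((hc.integral_hasStrictDerivAt 0 φ).hasDerivAt.sub_const _).const_mul _

lemma poisson_homologicalSolution {μ ω : ℝ} (hω : ω ≠ 0) {F : PhaseFn} {q Φ Q : ℝ}
    (hF : Continuous fun t => F t q Φ Q) (φ : ℝ) :
    poisson (arrangement μ ω 0) (homologicalSolution ω F) φ q Φ Q
      = average F q Φ Q - F φ q Φ Q := by
  rw [poisson_arrangement_zero, (hasDerivAt_homologicalSolution hF φ).deriv]
  field_simp; ring

lemma homologicalSolution_zero (ω : ℝ) : homologicalSolution ω 0 = 0 := by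
  funext φ q Φ Q
  simp [homologicalSolution, periodicPrimitive, average]

/-- The known part of the homological equation of order `m + 1`: the entry `K_{0,m+1}` computed
with `W_{m+1} = 0`. -/
def knownPart (μ ω : ℝ) (m : ℕ) : PhaseFn :=
  depritTriangle (generatorUpTo μ ω m) (arrangement μ ω) 0 (m + 1)

lemma generator_succ (μ ω : ℝ) (m : ℕ) :
    generator μ ω (m + 1) = homologicalSolution ω (knownPart μ ω m) := by
  unfold generator
  rw [generatorUpTo, Function.update_self]; rfl

lemma generatorUpTo_of_lt (μ ω : ℝ) {m k : ℕ} (h : m < k) : generatorUpTo μ ω m k = 0 := by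
  induction m with
  | zero => rfl
  | succ m ih => rw [generatorUpTo, Function.update_of_ne (by omega), ih (by omega)]

lemma generatorUpTo_of_le (μ ω : ℝ) {m k : ℕ} (h : k ≤ m) :
    generatorUpTo μ ω m k = generator μ ω k := by
  induction m with
  | zero => rw [Nat.le_zero.1 h]; rfl
  | succ m ih =>
    rcases h.eq_or_lt with rfl | h
    · rfl
    · rw [generatorUpTo, Function.update_of_ne (by omega), ih (by omega)]

lemma arrangement_eq_zero (μ ω : ℝ) (m : ℕ) (h0 : 0 < m) (h4 : m < 4) :
    arrangement μ ω m = 0 := by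
  funext φ q Φ Q
  simp [arrangement, h0.ne', h4]

lemma generator_eq_zero (μ ω : ℝ) (m : ℕ) (h4 : m < 4) : generator μ ω m = 0 := by
  induction m using Nat.strong_induction_on with
  | _ m ih =>
    rcases m with _ | m
    · rfl
    · rw [generator_succ, knownPart, depritTriangle_eq_zero (fun k hk hk4 => ?_)
        (arrangement_eq_zero μ ω) (m + 1) 0 (by omega) (by omega), homologicalSolution_zero]
      rcases lt_or_ge m k with h | h
      · exact generatorUpTo_of_lt μ ω h
      · rw [generatorUpTo_of_le μ ω h, ih k (by omega) hk4]

lemma generatorUpTo_eq_zero (μ ω : ℝ) (n m : ℕ) (_ : 0 < m) (h4 : m < 4) :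
    generatorUpTo μ ω n m = 0 := by
  rcases lt_or_ge n m with h | h
  · exact generatorUpTo_of_lt μ ω h
  · rw [generatorUpTo_of_le μ ω h, generator_eq_zero μ ω m h4]

section

variable (μ ω : ℝ)

lemma knownPart_of_lt_eight (m : ℕ) (h4 : 4 ≤ m + 1) (h8 : m + 1 < 8) :
    knownPart μ ω m = arrangement μ ω (m + 1) := by
  rw [knownPart, depritTriangle_of_lt_eight (generatorUpTo_eq_zero μ ω m)
    (arrangement_eq_zero μ ω) m 0 (by omega) (by omega), zero_add,
    generatorUpTo_of_lt μ ω (Nat.lt_succ_self m), poisson_zero_right, add_zero]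

lemma knownPart_seven :
    knownPart μ ω 7 = arrangement μ ω 8
      + (35 : ℝ) • poisson (arrangement μ ω 4) (generator μ ω 4)
      + (35 : ℝ) • poisson (normalizedTerm μ ω 4) (generator μ ω 4) := by
  rw [knownPart, depritTriangle_eight (generatorUpTo_eq_zero μ ω 7) (arrangement_eq_zero μ ω),
    generatorUpTo_of_lt μ ω (by norm_num : 7 < 8), generatorUpTo_of_le μ ω (by norm_num : 4 ≤ 7),
    poisson_zero_right, add_zero, normalizedTerm,
    depritTriangle_of_lt_eight (fun m _ h => generator_eq_zero μ ω m h)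
      (arrangement_eq_zero μ ω) 3 0 (by norm_num) (by norm_num)]

lemma knownPart_eight :
    knownPart μ ω 8 = arrangement μ ω 9
      + (56 : ℝ) • poisson (arrangement μ ω 5) (generator μ ω 4)
      + (70 : ℝ) • poisson (arrangement μ ω 4) (generator μ ω 5)
      + (70 : ℝ) • poisson (normalizedTerm μ ω 5) (generator μ ω 4)
      + (56 : ℝ) • poisson (normalizedTerm μ ω 4) (generator μ ω 5) := by
  have t := depritTriangle_of_lt_eight (fun m _ h => generator_eq_zero μ ω m h)
      (arrangement_eq_zero μ ω)
  rw [knownPart, depritTriangle_nine (generatorUpTo_eq_zero μ ω 8) (arrangement_eq_zero μ ω),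
    generatorUpTo_of_lt μ ω (by norm_num : 8 < 9), generatorUpTo_of_le μ ω (by norm_num : 4 ≤ 8),
    generatorUpTo_of_le μ ω (by norm_num : 5 ≤ 8),
    poisson_zero_right, add_zero, normalizedTerm, normalizedTerm,
    t 3 0 (by norm_num) (by norm_num), t 4 0 (by norm_num) (by norm_num)]

lemma normalizedTerm_eq_add (m : ℕ) (hm : m + 1 ≤ 9) (h4 : 4 ≤ m + 1) :
    normalizedTerm μ ω (m + 1) = knownPart μ ω m
      + poisson (arrangement μ ω 0) (generator μ ω (m + 1)) := by
  have hW := fun m (_ : 0 < m) h => generator_eq_zero μ ω m h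
  have hF := arrangement_eq_zero μ ω
  have t := depritTriangle_of_lt_eight hW hF
  rcases lt_or_ge (m + 1) 8 with h | h
  · rw [knownPart_of_lt_eight μ ω m h4 h, normalizedTerm, t m 0 (by omega) (by omega), zero_add]
  · have : m = 7 ∨ m = 8 := by omega
    rcases this with rfl | rfl
    · rw [knownPart_seven, normalizedTerm, normalizedTerm, depritTriangle_eight hW hF,
        t 3 0 (by norm_num) (by norm_num)]
      simp only [Nat.reduceAdd]
      abel
    · rw [knownPart_eight, normalizedTerm, normalizedTerm, normalizedTerm,
        depritTriangle_nine hW hF,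
        t 3 0 (by norm_num) (by norm_num), t 4 0 (by norm_num) (by norm_num)]
      simp only [Nat.reduceAdd]
      abel

variable {μ ω}

/-- The normalization replaces the known part of each order by its average. -/
lemma normalizedTerm_eq_average (hω : ω ≠ 0) {m : ℕ} (hm : m + 1 ≤ 9) (h4 : 4 ≤ m + 1)
    {q Φ Q : ℝ} (hc : Continuous fun t => knownPart μ ω m t q Φ Q) (φ : ℝ) :
    normalizedTerm μ ω (m + 1) φ q Φ Q = average (knownPart μ ω m) q Φ Q := by
  rw [normalizedTerm_eq_add μ ω m hm h4]
  simp only [Pi.add_apply]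
  rw [generator_succ, poisson_homologicalSolution hω hc]
  ring

end

/-! ### The periodic part of the inverse distance -/

/-- The primitive, vanishing at `0`, of the zero-mean part of `invDist`. -/
def invDistPrimitive (φ : ℝ) : ℝ := ∫ t in (0 : ℝ)..φ, (invDist t - Kt)

lemma hasDerivAt_invDistPrimitive (φ : ℝ) :
    HasDerivAt invDistPrimitive (invDist φ - Kt) φ :=
  ((by fun_prop : Continuous fun t => invDist t - Kt).integral_hasStrictDerivAt 0 φ).hasDerivAt

@[fun_prop]
lemma continuous_invDistPrimitive : Continuous invDistPrimitive :=
  continuous_iff_continuousAt.2 fun φ => (hasDerivAt_invDistPrimitive φ).continuousAt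

lemma invDistPrimitive_add_pi (φ : ℝ) : invDistPrimitive (φ + π) = invDistPrimitive φ := by
  have hper : Function.Periodic (fun t => invDist t - Kt) π := fun t => by
    simp only [invDist_add_pi]
  have I : ∀ a b, IntervalIntegrable (fun t => invDist t - Kt) MeasureTheory.volume a b :=
    fun a b => (by fun_prop : Continuous fun t => invDist t - Kt).intervalIntegrable _ _
  have h2 : ∫ t in (0 : ℝ)..(2 * π), (invDist t - Kt) = 0 := by
    have h := circleMean_add (f := invDist) (g := fun _ => -Kt) (by fun_prop) (by fun_prop)
    rw [circleMean_invDist, circleMean_const, add_neg_cancel] at h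
    unfold circleMean at h
    simp only [← sub_eq_add_neg] at h
    exact (mul_eq_zero.1 h).resolve_left (by positivity)
  have e := hper.intervalIntegral_add_eq 0 π
  have e' := hper.intervalIntegral_add_eq φ 0
  rw [zero_add] at e e'
  rw [← two_mul] at e
  have s := integral_add_adjacent_intervals (I 0 π) (I π (2 * π))
  have s' := integral_add_adjacent_intervals (I 0 φ) (I φ (φ + π))
  unfold invDistPrimitive
  linarith

lemma invDistPrimitive_neg (φ : ℝ) : invDistPrimitive (-φ) = -invDistPrimitive φ := by
  have h := integral_comp_neg (a := (0 : ℝ)) (b := φ) fun t => invDist t - Kt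
  have e : ∀ t, invDist (-t) = invDist t := fun t => by unfold invDist; rw [cos_neg]
  simp only [e, neg_zero] at h
  unfold invDistPrimitive
  rw [h, integral_symm]

lemma circleMean_invDistPrimitive : circleMean invDistPrimitive = 0 := by
  refine circleMean_eq_zero_of_pi_sub (fun t => ?_) fun t => ?_
  · rw [two_mul, ← add_assoc, invDistPrimitive_add_pi, invDistPrimitive_add_pi]
  · rw [← invDistPrimitive_neg, sub_eq_neg_add, invDistPrimitive_add_pi]

lemma circleMean_invDist_sq_sub :
    circleMean (fun t => invDist t * (invDist t - Kt)) = 1 / 2 - Kt ^ 2 := by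
  have e : (fun t => invDist t * (invDist t - Kt)) = fun t => invDist t ^ 2 + -Kt * invDist t := by
    funext t; ring
  rw [e, circleMean_add (by fun_prop) (by fun_prop), circleMean_const_mul, circleMean_invDist,
    circleMean_invDist_sq]
  ring

/-- Integration by parts against `invDistPrimitive` leaves the variance of `invDist`. -/
lemma circleMean_deriv_invDist_mul :
    circleMean (fun t => 3 * cos t * sin t * invDist t ^ 3 * invDistPrimitive t)
      = -(1 / 2 - Kt ^ 2) := by
  have h0 := circleMean_eq_zero_of_hasDerivAt
    (fun x => (hasDerivAt_invDist x).fun_mul (hasDerivAt_invDistPrimitive x)) (by fun_prop) (by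
      have h := invDistPrimitive_add_pi 0
      rw [← zero_add (2 * π), invDist_add_two_pi, two_mul, ← add_assoc, invDistPrimitive_add_pi,
        invDistPrimitive_add_pi])
  rw [circleMean_add (by fun_prop) (by fun_prop), circleMean_invDist_sq_sub] at h0
  linarith

/-! ### The terms of orders four and five -/

/-- The factor `μ / B` of the potential. -/
def coupling (μ ω Φ : ℝ) : ℝ := μ / semiminor ω Φ

lemma semiminor_pos {ω Φ : ℝ} (hω : 0 < ω) (hΦ : 0 < Φ) : 0 < semiminor ω Φ := by
  unfold semiminor; positivity

lemma semiminor_sq {ω Φ : ℝ} (hω : 0 < ω) (hΦ : 0 < Φ) : semiminor ω Φ ^ 2 = 2 * Φ / ω := by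
  unfold semiminor; rw [Real.sq_sqrt (by positivity)]

lemma hasDerivAt_coupling (μ : ℝ) {ω Φ : ℝ} (hω : 0 < ω) (hΦ : 0 < Φ) :
    HasDerivAt (coupling μ ω) (-(coupling μ ω Φ / (2 * Φ))) Φ := by
  have hB := semiminor_pos hω hΦ
  have h1 : HasDerivAt (fun t : ℝ => 2 * t / ω) (2 * 1 / ω) Φ :=
    ((hasDerivAt_id Φ).const_mul 2).div_const ω
  have h2 : HasDerivAt (semiminor ω) (2 * 1 / ω / (2 * semiminor ω Φ)) Φ :=
    h1.sqrt (by positivity)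
  refine ((hasDerivAt_const Φ μ).fun_div h2 hB.ne').congr_deriv ?_
  have h3 : ω * semiminor ω Φ ^ 2 = 2 * Φ := by rw [semiminor_sq hω hΦ]; field_simp
  unfold coupling
  field_simp
  linear_combination μ * h3

lemma sigma_sq_eq {ω Φ : ℝ} (hω : 0 < ω) (hΦ : 0 < Φ) (Q : ℝ) :
    3 / 2 * ω ^ 2 * semiminor ω Φ ^ 2 * sigma ω Φ Q ^ 2 = 3 / 2 * Q ^ 2 := by
  have hB := semiminor_pos hω hΦ
  unfold sigma; field_simp

/-- The product is free of square roots, which simplifies its derivative with respect to `Φ`. -/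
lemma coupling_mul_chi (μ : ℝ) {ω Φ : ℝ} (hω : 0 < ω) (hΦ : 0 < Φ) (q : ℝ) :
    coupling μ ω Φ * chi ω q Φ = μ * ω * q / (4 * Φ) := by
  have hB := semiminor_pos hω hΦ
  have h3 := semiminor_sq hω hΦ
  unfold coupling chi
  rw [div_mul_div_comm, show semiminor ω Φ * (2 * semiminor ω Φ) = 2 * semiminor ω Φ ^ 2 by ring,
    h3]
  field_simp; ring

section

variable {μ ω : ℝ}

lemma arrangement_four (hω : 0 < ω) {Φ : ℝ} (hΦ : 0 < Φ) (φ q Q : ℝ) :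
    arrangement μ ω 4 φ q Φ Q = -24 * (3 / 2 * Q ^ 2 + coupling μ ω Φ * invDist φ) := by
  simp only [arrangement]
  rw [(invRhoCoeff_eq _ _ _).1, sigma_sq_eq hω hΦ]
  norm_num [Nat.factorial, coupling]

lemma arrangement_of_gt_four (m : ℕ) (h : 4 < m) (φ q Φ Q : ℝ) :
    arrangement μ ω m φ q Φ Q
      = -m.factorial * coupling μ ω Φ * invRhoCoeff (m - 4) φ (chi ω q Φ) (sigma ω Φ Q) := by
  simp only [arrangement, coupling]
  rw [if_neg (by omega), if_neg (by omega), if_neg (by omega)]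

lemma arrangement_five (hω : 0 < ω) {Φ : ℝ} (hΦ : 0 < Φ) (φ q Q : ℝ) :
    arrangement μ ω 5 φ q Φ Q
      = 120 * μ * ω * (q / Φ) * (cos φ * invDist φ ^ 3) := by
  rw [arrangement_of_gt_four 5 (by norm_num), (invRhoCoeff_eq _ _ _).2.1]
  have h := coupling_mul_chi μ hω hΦ q
  have h' : coupling μ ω Φ * chi ω q Φ = μ * ω / 4 * (q / Φ) := by rw [h]; field_simp
  norm_num [Nat.factorial]
  linear_combination 480 * (cos φ * invDist φ ^ 3) * h'

lemma continuous_arrangement (hω : 0 < ω) {m : ℕ} (h4 : 4 ≤ m) (h9 : m ≤ 9) {Φ : ℝ} (hΦ : 0 < Φ)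
    (q Q : ℝ) : Continuous fun t => arrangement μ ω m t q Φ Q := by
  rcases h4.eq_or_lt with rfl | h
  · simp only [arrangement_four hω hΦ]; fun_prop
  · simp only [arrangement_of_gt_four m h]
    exact (continuous_invRhoCoeff (by omega) _ _).const_mul _

lemma average_arrangement_four (hω : 0 < ω) {Φ : ℝ} (hΦ : 0 < Φ) (q Q : ℝ) :
    average (arrangement μ ω 4) q Φ Q = -24 * (3 / 2 * Q ^ 2 + coupling μ ω Φ * Kt) := by
  rw [average_eq_circleMean]
  simp only [arrangement_four hω hΦ]
  rw [circleMean_const_mul, circleMean_add (by fun_prop) (by fun_prop), circleMean_const,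
    circleMean_const_mul, circleMean_invDist]

lemma average_arrangement_of_gt_four {m : ℕ} (h : 4 < m) (q Φ Q : ℝ) :
    average (arrangement μ ω m) q Φ Q = -m.factorial * coupling μ ω Φ
      * circleMean (fun t => invRhoCoeff (m - 4) t (chi ω q Φ) (sigma ω Φ Q)) := by
  rw [average_eq_circleMean]
  simp only [arrangement_of_gt_four m h]
  rw [circleMean_const_mul]

lemma normalizedTerm_of_lt_eight (hω : 0 < ω) {m : ℕ} (h4 : 4 ≤ m) (h8 : m < 8) {Φ : ℝ}
    (hΦ : 0 < Φ) (φ q Q : ℝ) :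
    normalizedTerm μ ω m φ q Φ Q = average (arrangement μ ω m) q Φ Q := by
  obtain ⟨m, rfl⟩ : ∃ k, m = k + 1 := ⟨m - 1, by omega⟩
  rw [← knownPart_of_lt_eight μ ω m h4 h8]
  refine normalizedTerm_eq_average hω.ne' (by omega) h4 ?_ φ
  rw [knownPart_of_lt_eight μ ω m h4 h8]
  exact continuous_arrangement hω h4 (by omega) hΦ q Q

lemma normalizedTerm_four (hω : 0 < ω) {Φ : ℝ} (hΦ : 0 < Φ) (φ q Q : ℝ) :
    normalizedTerm μ ω 4 φ q Φ Q = -24 * (3 / 2 * Q ^ 2 + coupling μ ω Φ * Kt) := by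
  rw [normalizedTerm_of_lt_eight hω (by norm_num) (by norm_num) hΦ,
    average_arrangement_four hω hΦ]

lemma normalizedTerm_five (hω : 0 < ω) {Φ : ℝ} (hΦ : 0 < Φ) (φ q Q : ℝ) :
    normalizedTerm μ ω 5 φ q Φ Q = 0 := by
  rw [normalizedTerm_of_lt_eight hω (by norm_num) (by norm_num) hΦ,
    average_arrangement_of_gt_four (by norm_num),
    circleMean_invRhoCoeff_odd (by decide), mul_zero]

lemma generator_four (hω : 0 < ω) {Φ : ℝ} (hΦ : 0 < Φ) (φ q Q : ℝ) :
    generator μ ω 4 φ q Φ Q = -(24 / ω) * (coupling μ ω Φ * invDistPrimitive φ) := by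
  have hp : ∀ t, periodicPrimitive (arrangement μ ω 4) t q Φ Q
      = (-24 * coupling μ ω Φ) * invDistPrimitive t := fun t => by
    unfold periodicPrimitive invDistPrimitive
    rw [average_arrangement_four hω hΦ, ← intervalIntegral.integral_const_mul]
    congr 1; funext s
    rw [arrangement_four hω hΦ]; ring
  rw [generator_succ, knownPart_of_lt_eight μ ω 3 (by norm_num) (by norm_num),
    homologicalSolution, average_eq_circleMean]
  simp only [Nat.reduceAdd, hp]
  rw [circleMean_const_mul, circleMean_invDistPrimitive]
  ring

lemma hasDerivAt_sin_mul_invDist (φ : ℝ) :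
    HasDerivAt (fun t => sin t * invDist t) (4 * (cos φ * invDist φ ^ 3)) φ := by
  refine ((hasDerivAt_sin φ).fun_mul (hasDerivAt_invDist φ)).congr_deriv ?_
  linear_combination (3 * cos φ * invDist φ ^ 3) * sin_sq φ - cos φ * invDist φ * invDist_sq φ

lemma generator_five (hω : 0 < ω) {Φ : ℝ} (hΦ : 0 < Φ) (φ q Q : ℝ) :
    generator μ ω 5 φ q Φ Q = 30 * μ * (q / Φ) * (sin φ * invDist φ) := by
  have ha : average (arrangement μ ω 5) q Φ Q = 0 := by
    rw [average_arrangement_of_gt_four (by norm_num), circleMean_invRhoCoeff_odd (by decide),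
      mul_zero]
  have hp : ∀ t, periodicPrimitive (arrangement μ ω 5) t q Φ Q
      = (30 * μ * ω * (q / Φ)) * (sin t * invDist t) := fun t => by
    unfold periodicPrimitive
    simp only [ha, sub_zero, arrangement_five hω hΦ]
    rw [intervalIntegral.integral_const_mul]
    have h := integral_eq_sub_of_hasDerivAt (a := 0) (b := t)
      (fun x _ => hasDerivAt_sin_mul_invDist x)
      ((by fun_prop : Continuous fun x => 4 * (cos x * invDist x ^ 3)).intervalIntegrable _ _)
    rw [intervalIntegral.integral_const_mul, sin_zero, zero_mul, sub_zero] at h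
    linear_combination (30 * μ * ω * (q / Φ)) * h
  rw [generator_succ, knownPart_of_lt_eight μ ω 4 (by norm_num) (by norm_num),
    homologicalSolution, average_eq_circleMean]
  simp only [Nat.reduceAdd, hp]
  rw [circleMean_const_mul, circleMean_eq_zero_of_add_pi (f := fun t => sin t * invDist t)
    fun x => by rw [sin_add_pi, invDist_add_pi]; ring]
  field_simp; ring

/-! ### Brackets of orders eight and nine -/

/-- The bracket at a point with `0 < Φ` only depends on the functions for `0 < Φ`. -/
lemma poisson_congr {F F' G G' : PhaseFn} (hF : ∀ φ q Φ Q, 0 < Φ → F φ q Φ Q = F' φ q Φ Q)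
    (hG : ∀ φ q Φ Q, 0 < Φ → G φ q Φ Q = G' φ q Φ Q) {φ q Φ Q : ℝ} (hΦ : 0 < Φ) :
    poisson F G φ q Φ Q = poisson F' G' φ q Φ Q := by
  have eF : (fun t => F φ q t Q) =ᶠ[nhds Φ] fun t => F' φ q t Q :=
    (eventually_gt_nhds hΦ).mono fun t ht => hF _ _ _ _ ht
  have eG : (fun t => G φ q t Q) =ᶠ[nhds Φ] fun t => G' φ q t Q :=
    (eventually_gt_nhds hΦ).mono fun t ht => hG _ _ _ _ ht
  simp only [poisson, eF.deriv_eq, eG.deriv_eq, hF _ _ _ _ hΦ, hG _ _ _ _ hΦ]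

lemma poisson_eq {F G : PhaseFn} {φ q Φ Q a b c d a' b' c' d' : ℝ}
    (ha : HasDerivAt (fun t => F t q Φ Q) a φ) (hb : HasDerivAt (fun t => F φ q t Q) b Φ)
    (hc : HasDerivAt (fun t => F φ t Φ Q) c q) (hd : HasDerivAt (fun t => F φ q Φ t) d Q)
    (ha' : HasDerivAt (fun t => G t q Φ Q) a' φ) (hb' : HasDerivAt (fun t => G φ q t Q) b' Φ)
    (hc' : HasDerivAt (fun t => G φ t Φ Q) c' q) (hd' : HasDerivAt (fun t => G φ q Φ t) d' Q) :
    poisson F G φ q Φ Q = a * b' - b * a' + c * d' - d * c' := by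
  unfold poisson
  rw [ha.deriv, hb.deriv, hc.deriv, hd.deriv, ha'.deriv, hb'.deriv, hc'.deriv, hd'.deriv]

/-- A bracket of `-24 (3 / 2 Q² + μ / B f(φ))` with `W₄`; the cases `f = 1 / ρ` and `f` constant
cover `K_{4,0}` and `K_{0,4}`. -/
lemma poisson_generator_four (hω : 0 < ω) {F : PhaseFn} {f f' : ℝ → ℝ}
    (hf : ∀ φ, HasDerivAt f (f' φ) φ)
    (hF : ∀ φ q Φ Q, 0 < Φ → F φ q Φ Q = -24 * (3 / 2 * Q ^ 2 + coupling μ ω Φ * f φ))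
    {Φ : ℝ} (hΦ : 0 < Φ) (φ q Q : ℝ) :
    poisson F (generator μ ω 4) φ q Φ Q = -(288 * coupling μ ω Φ ^ 2 / (ω * Φ))
      * (f' φ * invDistPrimitive φ - f φ * (invDist φ - Kt)) := by
  have hg := hasDerivAt_coupling μ hω hΦ
  rw [poisson_congr hF (fun φ q Φ Q hΦ => generator_four hω hΦ φ q Q) hΦ,
    poisson_eq (((hf φ).const_mul _).const_add _ |>.const_mul _)
      (((hg.mul_const _).const_add _).const_mul _) (hasDerivAt_const _ _)
      (((((hasDerivAt_id Q).fun_pow 2).const_mul (3 / 2)).add_const _).const_mul _)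
      (((hasDerivAt_invDistPrimitive φ).const_mul _).const_mul _)
      ((hg.mul_const _).const_mul _) (hasDerivAt_const _ _) (hasDerivAt_const _ _)]
  field_simp
  ring

/-- A bracket of `-24 (3 / 2 Q² + μ / B f(φ))` with `W₅`. The term `Q²` contributes, since `W₅` is
proportional to `q`. -/
lemma poisson_generator_five (hω : 0 < ω) {F : PhaseFn} {f f' : ℝ → ℝ}
    (hf : ∀ φ, HasDerivAt f (f' φ) φ)
    (hF : ∀ φ q Φ Q, 0 < Φ → F φ q Φ Q = -24 * (3 / 2 * Q ^ 2 + coupling μ ω Φ * f φ))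
    {Φ : ℝ} (hΦ : 0 < Φ) (φ q Q : ℝ) :
    poisson F (generator μ ω 5) φ q Φ Q =
      720 * μ * coupling μ ω Φ * q / Φ ^ 2
        * (f' φ * (sin φ * invDist φ) - 2 * f φ * (cos φ * invDist φ ^ 3))
      + 2160 * μ * Q / Φ * (sin φ * invDist φ) := by
  have hg := hasDerivAt_coupling μ hω hΦ
  have hs := hasDerivAt_sin_mul_invDist φ
  rw [poisson_congr hF (fun φ q Φ Q hΦ => generator_five hω hΦ φ q Q) hΦ,
    poisson_eq (((hf φ).const_mul _).const_add _ |>.const_mul _)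
      (((hg.mul_const _).const_add _).const_mul _) (hasDerivAt_const _ _)
      (((((hasDerivAt_id Q).fun_pow 2).const_mul (3 / 2)).add_const _).const_mul _)
      (hs.const_mul _)
      ((((hasDerivAt_const Φ q).fun_div (hasDerivAt_id Φ) hΦ.ne').const_mul _).mul_const _)
      ((((hasDerivAt_id q).div_const Φ).const_mul _).mul_const _) (hasDerivAt_const _ _)]
  simp only [id]
  field_simp
  ring

lemma poisson_arrangement_five_generator_four (hω : 0 < ω) {Φ : ℝ} (hΦ : 0 < Φ) (φ q Q : ℝ) :
    poisson (arrangement μ ω 5) (generator μ ω 4) φ q Φ Q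
      = 1440 * μ * coupling μ ω Φ * q / Φ ^ 2
        * ((-sin φ * invDist φ ^ 3 + cos φ * (9 * cos φ * sin φ * invDist φ ^ 5))
            * invDistPrimitive φ
          - 2 * (cos φ * invDist φ ^ 3) * (invDist φ - Kt)) := by
  have hg := hasDerivAt_coupling μ hω hΦ
  have hc := (hasDerivAt_cos φ).fun_mul (hasDerivAt_invDist_pow 3 φ)
  rw [poisson_congr (fun φ q Φ Q hΦ => arrangement_five hω hΦ φ q Q)
      (fun φ q Φ Q hΦ => generator_four hω hΦ φ q Q) hΦ,
    poisson_eq (hc.const_mul _)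
      ((((hasDerivAt_const Φ q).fun_div (hasDerivAt_id Φ) hΦ.ne').const_mul _).mul_const _)
      ((((hasDerivAt_id q).div_const Φ).const_mul _).mul_const _) (hasDerivAt_const _ _)
      (((hasDerivAt_invDistPrimitive φ).const_mul _).const_mul _)
      ((hg.mul_const _).const_mul _) (hasDerivAt_const _ _) (hasDerivAt_const _ _)]
  simp only [id]
  push_cast
  field_simp
  ring

lemma poisson_zero_of_pos {F : PhaseFn} (G : PhaseFn)
    (hF : ∀ φ q Φ Q, 0 < Φ → F φ q Φ Q = 0) {Φ : ℝ} (hΦ : 0 < Φ) (φ q Q : ℝ) :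
    poisson F G φ q Φ Q = 0 := by
  rw [poisson_congr (F' := 0) (G' := G) hF (fun _ _ _ _ _ => rfl) hΦ, poisson_zero_left]; rfl

lemma knownPart_seven_eq (hω : 0 < ω) {Φ : ℝ} (hΦ : 0 < Φ) (φ q Q : ℝ) :
    knownPart μ ω 7 φ q Φ Q
      = -40320 * coupling μ ω Φ * invRhoCoeff 4 φ (chi ω q Φ) (sigma ω Φ Q)
      + -(10080 * coupling μ ω Φ ^ 2 / (ω * Φ))
        * (3 * cos φ * sin φ * invDist φ ^ 3 * invDistPrimitive φ
          + -1 * (invDist φ * (invDist φ - Kt)) + (-Kt * invDist φ + Kt ^ 2)) := by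
  rw [knownPart_seven]
  simp only [Pi.add_apply, Pi.smul_apply, smul_eq_mul]
  rw [poisson_generator_four hω hasDerivAt_invDist
      (fun φ q Φ Q hΦ => arrangement_four hω hΦ φ q Q) hΦ,
    poisson_generator_four hω (fun φ => hasDerivAt_const φ Kt)
      (fun φ q Φ Q hΦ => normalizedTerm_four hω hΦ φ q Q) hΦ,
    arrangement_of_gt_four 8 (by norm_num)]
  norm_num [Nat.factorial]
  ring

lemma normalizedTerm_eight (hω : 0 < ω) {Φ : ℝ} (hΦ : 0 < Φ) (φ q Q : ℝ) :
    normalizedTerm μ ω 8 φ q Φ Q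
      = -40320 * coupling μ ω Φ * ((11 * Kt - 14 * Et) / 18 * chi ω q Φ ^ 4
          + 2 / 3 * (4 * Et - Kt) * sigma ω Φ Q ^ 2)
        + 20160 * coupling μ ω Φ ^ 2 / (ω * Φ) * (1 / 2 - Kt ^ 2) := by
  have h4 := continuous_invRhoCoeff (n := 4) (by norm_num) (chi ω q Φ) (sigma ω Φ Q)
  rw [normalizedTerm_eq_average hω.ne' (by norm_num) (by norm_num), average_eq_circleMean]
  · simp only [knownPart_seven_eq hω hΦ]
    rw [circleMean_add (by fun_prop) (by fun_prop), circleMean_const_mul, circleMean_const_mul,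
      circleMean_add (by fun_prop) (by fun_prop), circleMean_add (by fun_prop) (by fun_prop),
      circleMean_add (by fun_prop) (by fun_prop), circleMean_const_mul, circleMean_const_mul,
      circleMean_const, circleMean_invDist, circleMean_invDist_sq_sub,
      circleMean_deriv_invDist_mul, circleMean_invRhoCoeff_four]
    ring
  · simp only [knownPart_seven_eq hω hΦ]
    fun_prop

/-- All brackets of order nine change sign under `φ ↦ φ + π`, and `T₅` under
`φ ↦ π - φ`, `χ ↦ -χ`. -/
lemma normalizedTerm_nine (hω : 0 < ω) {Φ : ℝ} (hΦ : 0 < Φ) (φ q Q : ℝ) :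
    normalizedTerm μ ω 9 φ q Φ Q = 0 := by
  -- the brackets of the known part, restricted to the orbit of the angle
  let f : ℝ → ℝ := fun t =>
    56 * (1440 * μ * coupling μ ω Φ * q / Φ ^ 2
        * ((-sin t * invDist t ^ 3 + cos t * (9 * cos t * sin t * invDist t ^ 5))
            * invDistPrimitive t
          - 2 * (cos t * invDist t ^ 3) * (invDist t - Kt)))
    + 70 * (720 * μ * coupling μ ω Φ * q / Φ ^ 2
        * (3 * cos t * sin t * invDist t ^ 3 * (sin t * invDist t)
          - 2 * invDist t * (cos t * invDist t ^ 3))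
      + 2160 * μ * Q / Φ * (sin t * invDist t))
    + 56 * (720 * μ * coupling μ ω Φ * q / Φ ^ 2
        * (0 * (sin t * invDist t) - 2 * Kt * (cos t * invDist t ^ 3))
      + 2160 * μ * Q / Φ * (sin t * invDist t))
  have hfc : Continuous f := by simp only [f]; fun_prop
  have hfs : ∀ t, f (t + π) = -f t := fun t => by
    simp only [f, sin_add_pi, cos_add_pi, invDist_add_pi, invDistPrimitive_add_pi]
    ring
  have hf : ∀ t, knownPart μ ω 8 t q Φ Q = arrangement μ ω 9 t q Φ Q + f t := fun t => by
    rw [knownPart_eight]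
    simp only [Pi.add_apply, Pi.smul_apply, smul_eq_mul]
    rw [poisson_arrangement_five_generator_four hω hΦ,
      poisson_generator_five hω hasDerivAt_invDist
        (fun φ q Φ Q hΦ => arrangement_four hω hΦ φ q Q) hΦ,
      poisson_generator_five hω (fun φ => hasDerivAt_const φ Kt)
        (fun φ q Φ Q hΦ => normalizedTerm_four hω hΦ φ q Q) hΦ,
      poisson_zero_of_pos _ (fun φ q Φ Q hΦ => normalizedTerm_five hω hΦ φ q Q) hΦ]
    simp only [f]
    ring
  have h9 := continuous_arrangement (μ := μ) hω (m := 9) (by norm_num) le_rfl hΦ q Q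
  rw [normalizedTerm_eq_average hω.ne' (by norm_num) (by norm_num), average_eq_circleMean]
  · simp only [hf]
    rw [circleMean_add h9 hfc, circleMean_eq_zero_of_add_pi hfs, ← average_eq_circleMean,
      average_arrangement_of_gt_four (by norm_num), circleMean_invRhoCoeff_odd (by decide)]
    simp
  · simp only [hf]
    fun_prop

end

/-! ### Bounds for the elliptic integrals -/

lemma circleMean_mono {f g : ℝ → ℝ} (hf : Continuous f) (hg : Continuous g) (h : ∀ t, f t ≤ g t) :
    circleMean f ≤ circleMean g := by
  unfold circleMean
  exact mul_le_mul_of_nonneg_left (intervalIntegral.integral_mono (by positivity)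
    (hf.intervalIntegrable _ _) (hg.intervalIntegrable _ _) h) (by positivity)

lemma circleMean_sin_pow (n : ℕ) :
    circleMean (fun t => sin t ^ (2 * n))
      = ∏ i ∈ Finset.range n, (2 * (i : ℝ) + 1) / (2 * i + 2) := by
  have I : ∀ a b, IntervalIntegrable (fun t => sin t ^ (2 * n)) MeasureTheory.volume a b :=
    fun a b => (by fun_prop : Continuous fun t => sin t ^ (2 * n)).intervalIntegrable _ _
  have e : ∫ t in (0 : ℝ)..π, sin t ^ (2 * n) = ∫ t in π..(2 * π), sin t ^ (2 * n) := by
    have h := integral_comp_add_right (a := (0 : ℝ)) (b := π) (fun t => sin t ^ (2 * n)) π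
    simp only [sin_add_pi, (even_two_mul n).neg_pow, zero_add] at h
    rw [h, two_mul π]
  have h := integral_add_adjacent_intervals (I 0 π) (I π (2 * π))
  rw [← e, integral_sin_pow_even] at h
  unfold circleMean
  rw [← h]
  field_simp; ring

/-- The mean of a polynomial in `sin² t`, given by the list of its coefficients. -/
lemma circleMean_polynomial_sin_sq (l : List ℝ) (n : ℕ) :
    circleMean (fun t => ∑ i ∈ Finset.range n, l.getD i 0 * sin t ^ (2 * i))
      = ∑ i ∈ Finset.range n,
          l.getD i 0 * ∏ j ∈ Finset.range i, (2 * (j : ℝ) + 1) / (2 * j + 2) := by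
  induction n with
  | zero => simpa using circleMean_const 0
  | succ n ih =>
    simp only [Finset.sum_range_succ]
    rw [circleMean_add (by fun_prop) (by fun_prop), ih, circleMean_const_mul, circleMean_sin_pow]

/-- Newton's step for `r = 1 / √d` from any `b ≥ 0` stays below it, and one term more of the
binomial series, with the coefficient `3 / 8` raised to `1 / 2`, lies above it if `d b²` is near
`1`. -/
lemma newton_bounds {r b d : ℝ} (hr : 0 < r) (hb : 0 ≤ b) (hd : r ^ 2 * d = 1) :
    b * (3 - d * b ^ 2) / 2 ≤ r ∧
    (3 / 4 ≤ d * b ^ 2 → r ≤ b * (2 - 3 / 2 * (d * b ^ 2) + (d * b ^ 2) ^ 2 / 2)) := by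
  obtain ⟨y, hy⟩ : ∃ y, b = r * y := ⟨b / r, by field_simp⟩
  have hy0 : 0 ≤ y := by
    by_contra h
    nlinarith
  have hz : d * b ^ 2 = y ^ 2 := by rw [hy]; linear_combination y ^ 2 * hd
  rw [hz, hy]
  refine ⟨?_, fun h => ?_⟩
  · nlinarith [mul_nonneg hr.le (mul_nonneg (sq_nonneg (1 - y)) (by linarith : 0 ≤ 2 + y))]
  · have h1 : 17 / 20 ≤ y := by nlinarith
    have h2 : 0 ≤ y ^ 3 / 2 + y ^ 2 - 1 := by nlinarith [pow_le_pow_left₀ (by norm_num) h1 3]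
    nlinarith [mul_nonneg hr.le (mul_nonneg (sq_nonneg (y - 1)) h2)]

/-- The polynomial in `w = sin² t` approximating `1 / ρ = 1 / √(4 - 3 w)` with relative error about
three per cent. -/
def approxInvDist (w : ℝ) : ℝ := (51 + 4 * w + 42 * w ^ 2) / 100

lemma approxInvDist_bounds (t : ℝ) :
    let w := sin t ^ 2
    let b := approxInvDist w
    let z := (4 - 3 * w) * b ^ 2
    b * (3 - z) / 2 ≤ invDist t ∧ invDist t ≤ b * (2 - 3 / 2 * z + z ^ 2 / 2) := by
  intro w b z
  have hw0 : 0 ≤ w := sq_nonneg _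
  have hw1 : w ≤ 1 := sin_sq_le_one t
  have hd : invDist t ^ 2 * (4 - 3 * w) = 1 := by
    have h := invDist_sq t
    rw [cos_sq'] at h
    linear_combination h
  have hb : 0 ≤ b := by simp only [b, approxInvDist]; positivity
  have h := newton_bounds (invDist_pos t) hb hd
  refine ⟨h.1, h.2 ?_⟩
  -- the products in `w` and `v = 1 - w` below are nonnegative on `[0, 1]`
  obtain ⟨v, hv⟩ : ∃ v, w = 1 - v := ⟨1 - w, by ring⟩
  have hv0 : 0 ≤ v := by linarith
  simp only [b, approxInvDist]
  nlinarith [mul_nonneg hw0 hv0, mul_nonneg (mul_nonneg hw0 hv0) hv0,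
    mul_nonneg (mul_nonneg hw0 hv0) hw0, mul_nonneg (mul_nonneg hw0 hv0) (mul_nonneg hw0 hv0),
    mul_nonneg hv0 (sq_nonneg (v * (1 - v))), sq_nonneg (v * (1 - 2 * v))]

/-- Lower bound for a mean by a polynomial in `sin² t` with list of coefficients `l`. -/
lemma le_circleMean_of_polynomial (l : List ℝ) (n : ℕ) {f : ℝ → ℝ} (hf : Continuous f)
    (h : ∀ t, ∑ i ∈ Finset.range n, l.getD i 0 * sin t ^ (2 * i) ≤ f t) :
    ∑ i ∈ Finset.range n, l.getD i 0 * ∏ j ∈ Finset.range i, (2 * (j : ℝ) + 1) / (2 * j + 2)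
      ≤ circleMean f :=
  (circleMean_polynomial_sin_sq l n).symm.trans_le (circleMean_mono (by fun_prop) hf h)

/-- Upper bound for a mean by a polynomial in `sin² t` with list of coefficients `l`. -/
lemma circleMean_le_of_polynomial (l : List ℝ) (n : ℕ) {f : ℝ → ℝ} (hf : Continuous f)
    (h : ∀ t, f t ≤ ∑ i ∈ Finset.range n, l.getD i 0 * sin t ^ (2 * i)) :
    circleMean f
      ≤ ∑ i ∈ Finset.range n, l.getD i 0 * ∏ j ∈ Finset.range i, (2 * (j : ℝ) + 1) / (2 * j + 2) :=
  (circleMean_mono hf (by fun_prop) h).trans_eq (circleMean_polynomial_sin_sq l n)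

/- The coefficients below are those of the bounds in `approxInvDist_bounds`, multiplied by
`4 - 3 sin² t` for `Et` and by a power of ten that makes them integers. -/

lemma Kt_lower : 0.686 ≤ Kt := by
  have h := le_circleMean_of_polynomial [4996980, 1965525, 164700, 3923170, -4666080, 3655260,
    -1164240, 1111320] 8 (f := fun t => 10 ^ 7 * invDist t) (by fun_prop) fun t => by
      have := (approxInvDist_bounds t).1
      simp only [approxInvDist] at this
      simp [Finset.sum_range_succ]
      linarith
  rw [circleMean_const_mul, circleMean_invDist] at h
  norm_num [Finset.sum_range_succ, Finset.prod_range_succ] at h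
  linarith

lemma Kt_upper : Kt ≤ 0.6866 := by
  have h := circleMean_le_of_polynomial [500114200800, 183870414800, 145839634950, -134564235000,
    626164030500, -1130404724800, 1639562617200, -1539200923200, 1166799060000, -780083136000,
    392273733600, -128824214400, 58811054400] 13 (f := fun t => 10 ^ 12 * invDist t)
    (by fun_prop) fun t => by
      have := (approxInvDist_bounds t).2
      simp only [approxInvDist] at this
      simp [Finset.sum_range_succ]
      linarith
  rw [circleMean_const_mul, circleMean_invDist] at h
  norm_num [Finset.sum_range_succ, Finset.prod_range_succ] at h
  linarith

lemma one_add_three_cos_sq_eq (t : ℝ) : 1 + 3 * cos t ^ 2 = 4 - 3 * sin t ^ 2 := by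
  rw [cos_sq']; ring

lemma Et_lower : 0.38534 ≤ Et := by
  have h := le_circleMean_of_polynomial [19987920, -7128840, -5237775, 15198580, -30433830,
    28619280, -15622740, 7938000, -3333960] 9
    (f := fun t => 10 ^ 7 * ((1 + 3 * cos t ^ 2) * invDist t)) (by fun_prop) fun t => by
      have := mul_le_mul_of_nonneg_left (approxInvDist_bounds t).1
        (by positivity : 0 ≤ 1 + 3 * cos t ^ 2)
      rw [one_add_three_cos_sq_eq] at this ⊢
      simp only [approxInvDist] at this
      simp [Finset.sum_range_succ]
      linarith
  rw [circleMean_const_mul, circleMean_dist] at h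
  norm_num [Finset.sum_range_succ, Finset.prod_range_succ] at h
  linarith

lemma Et_upper : Et ≤ 0.3856 := by
  have h := circleMean_le_of_polynomial [2000456803200, -764860943200, 31747295400, -975775844850,
    2908348827000, -6400110990700, 9949464643200, -11075491544400, 9284799009600, -6620729724000,
    3909344342400, -1692118058400, 621716860800, -176433163200] 14
    (f := fun t => 10 ^ 12 * ((1 + 3 * cos t ^ 2) * invDist t)) (by fun_prop) fun t => by
      have := mul_le_mul_of_nonneg_left (approxInvDist_bounds t).2
        (by positivity : 0 ≤ 1 + 3 * cos t ^ 2)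
      rw [one_add_three_cos_sq_eq] at this ⊢
      simp only [approxInvDist] at this
      simp [Finset.sum_range_succ]
      linarith
  rw [circleMean_const_mul, circleMean_dist] at h
  norm_num [Finset.sum_range_succ, Finset.prod_range_succ] at h
  linarith

/-! ### Signs of the coefficients -/

lemma Kt_sub_Et_pos : 0 < Kt - Et := by linarith [Kt_lower, Et_upper]

lemma one_sub_two_Kt_sq_pos : 0 < 1 - 2 * Kt ^ 2 := by nlinarith [Kt_lower, Kt_upper]

lemma three_Kt_sq_sub_one_pos : 0 < 3 * Kt ^ 2 - 1 := by nlinarith [Kt_lower]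

lemma ratioMinus_lt_ratioPlus : ratioMinus < ratioPlus := by
  have hS := Real.sqrt_pos.2 three_Kt_sq_sub_one_pos
  unfold ratioMinus ratioPlus
  exact mul_lt_mul_of_pos_left ((div_lt_div_iff_of_pos_right one_sub_two_Kt_sq_pos).2
    (by linarith)) Kt_sub_Et_pos

/-- The quadratic polynomial `b1` in factored form. -/
lemma b1_eq (μ ω Φ : ℝ) : b1 μ ω Φ = (1 - 2 * Kt ^ 2) / (Kt - Et) ^ 2
    * ((freqRatio μ ω Φ - ratioMinus) * (freqRatio μ ω Φ - ratioPlus)) := by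
  have hD := Kt_sub_Et_pos
  have ha := one_sub_two_Kt_sq_pos
  have hS := Real.sq_sqrt three_Kt_sq_sub_one_pos.le
  unfold b1 ratioMinus ratioPlus
  set S := √(3 * Kt ^ 2 - 1)
  set x := freqRatio μ ω Φ
  set D := Kt - Et
  have ha' := ha.ne'
  field_simp
  linear_combination D ^ 2 * hS

/-- Rationalizing the numerator removes the small denominator `1 - 2 K̃²`. -/
lemma ratioMinus_eq : ratioMinus = (Kt - Et) / (Kt + √(3 * Kt ^ 2 - 1)) := by
  have ha := one_sub_two_Kt_sq_pos.ne'
  have hS := Real.sq_sqrt three_Kt_sq_sub_one_pos.le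
  have h : 0 < Kt + √(3 * Kt ^ 2 - 1) := by
    have := Kt_lower
    have := Real.sqrt_nonneg (3 * Kt ^ 2 - 1)
    linarith
  unfold ratioMinus
  set S := √(3 * Kt ^ 2 - 1)
  rw [eq_div_iff h.ne', mul_assoc, div_mul_eq_mul_div,
    show (Kt - S) * (Kt + S) = 1 - 2 * Kt ^ 2 by linear_combination -hS, div_self ha, mul_one]

lemma abs_ratioMinus_sub_lt : |ratioMinus - 0.226| < 0.0005 := by
  have h1 := Kt_lower
  have h2 := Kt_upper
  have h3 := Et_lower
  have h4 := Et_upper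
  have hS := Real.sq_sqrt three_Kt_sq_sub_one_pos.le
  have hS0 := Real.sqrt_nonneg (3 * Kt ^ 2 - 1)
  rw [ratioMinus_eq]
  set S := √(3 * Kt ^ 2 - 1)
  have hp : 0 < Kt + S := by linarith
  -- both bounds on `S` follow by squaring; after that they are quadratic inequalities in `Kt`
  have hu : Kt - 0.38534 - 0.2265 * Kt < 0.2265 * S :=
    (abs_lt.1 (abs_lt_of_sq_lt_sq (by rw [mul_pow, hS]; nlinarith) (by positivity))).2
  have hl : 0.2255 * S < Kt - 0.3856 - 0.2255 * Kt :=
    (abs_lt.1 (abs_lt_of_sq_lt_sq (by rw [mul_pow, hS]; nlinarith) (by linarith))).2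
  rw [abs_lt]
  constructor
  · rw [lt_sub_iff_add_lt, lt_div_iff₀ hp]; linarith
  · rw [sub_lt_iff_lt_add, div_lt_iff₀ hp]; linarith

lemma librationFreq_sq {μ ω Φ : ℝ} (hμ : 0 < μ) (hω : 0 < ω) (hΦ : 0 < Φ) :
    librationFreq μ ω Φ ^ 2 = (Kt - Et) * (μ / semiminor ω Φ ^ 3) := by
  have := semiminor_pos hω hΦ
  have := Kt_sub_Et_pos
  exact Real.sq_sqrt (by positivity)

lemma freqRatio_pos {μ ω Φ : ℝ} (hμ : 0 < μ) (hω : 0 < ω) (hΦ : 0 < Φ) :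
    0 < freqRatio μ ω Φ := by
  have := semiminor_pos hω hΦ
  have := Kt_sub_Et_pos
  unfold freqRatio
  rw [librationFreq_sq hμ hω hΦ]
  positivity

/-- The coupling in terms of `Ω² / ω²`. -/
lemma coupling_eq {μ ω Φ : ℝ} (hμ : 0 < μ) (hω : 0 < ω) (hΦ : 0 < Φ) :
    coupling μ ω Φ = 2 * ω * Φ * (freqRatio μ ω Φ / (Kt - Et)) := by
  have hB := semiminor_pos hω hΦ
  have hD := Kt_sub_Et_pos
  have h3 : ω * semiminor ω Φ ^ 2 = 2 * Φ := by rw [semiminor_sq hω hΦ]; field_simp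
  unfold coupling freqRatio
  rw [librationFreq_sq hμ hω hΦ]
  field_simp
  linarith

end HillDRO

end

theorem mainTheorem3 (μ ω : ℝ) (hμ : 0 < μ) (hω : 0 < ω) :
    -- the terms of the normalized Hamiltonian through order nine do not depend on the angle
    (∀ m : ℕ, m ≤ 9 → ∀ φ φ' q Φ Q : ℝ, 0 < Φ →
      normalizedTerm μ ω m φ q Φ Q = normalizedTerm μ ω m φ' q Φ Q) ∧
    -- the normalized Hamiltonian through order eight
    (∀ φ q Φ Q : ℝ, 0 < Φ →
      normalizedHamiltonian μ ω 8 φ q Φ Q =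
        ω * Φ * (b1 μ ω Φ - b2 μ ω Φ * sigma ω Φ Q ^ 2
          - 2 * b3 μ ω Φ * chi ω q Φ ^ 2 - b4 μ ω Φ * chi ω q Φ ^ 4)) ∧
    -- signs of the coefficients
    (∀ Φ : ℝ, 0 < Φ → 0 < b2 μ ω Φ ∧ 0 < b3 μ ω Φ ∧ 0 < b4 μ ω Φ) ∧
    (∀ Φ : ℝ, 0 < Φ →
      (b1 μ ω Φ = 0 ↔ freqRatio μ ω Φ = ratioMinus ∨ freqRatio μ ω Φ = ratioPlus)) ∧
    (∀ Φ : ℝ, 0 < Φ → freqRatio μ ω Φ < ratioMinus → 0 < b1 μ ω Φ) ∧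
    (∀ Φ : ℝ, 0 < Φ → ratioMinus < freqRatio μ ω Φ → freqRatio μ ω Φ < ratioPlus →
      b1 μ ω Φ < 0) ∧
    |ratioMinus - 0.226| < 0.0005 ∧
    -- the ninth-order term vanishes
    (∀ φ q Φ Q : ℝ, 0 < Φ → normalizedTerm μ ω 9 φ q Φ Q = 0) := by
  have hD := Kt_sub_Et_pos
  have hlead : 0 < (1 - 2 * Kt ^ 2) / (Kt - Et) ^ 2 :=
    div_pos one_sub_two_Kt_sq_pos (by positivity)
  have hN0 : ∀ φ q Φ Q, normalizedTerm μ ω 0 φ q Φ Q = ω * Φ := fun φ q Φ Q => by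
    rw [normalizedTerm, depritTriangle_zero]; simp [arrangement]
  have hN : ∀ m, 0 < m → m < 4 → normalizedTerm μ ω m = 0 := fun m h0 h4 =>
    depritTriangle_eq_zero (fun m _ h => generator_eq_zero μ ω m h) (arrangement_eq_zero μ ω) m 0
      (by omega) (by omega)
  refine ⟨fun m hm φ φ' q Φ Q hΦ => ?_, fun φ q Φ Q hΦ => ?_, fun Φ hΦ => ?_, fun Φ hΦ => ?_,
    fun Φ hΦ h => ?_, fun Φ hΦ h h' => ?_, abs_ratioMinus_sub_lt,
    fun φ q Φ Q hΦ => normalizedTerm_nine hω hΦ φ q Q⟩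
  · rcases lt_or_ge m 4 with h4 | h4
    · rcases Nat.eq_zero_or_pos m with rfl | h0
      · rw [hN0, hN0]
      · rw [hN m h0 h4]; rfl
    · rcases lt_or_ge m 8 with h8 | h8
      · rw [normalizedTerm_of_lt_eight hω h4 h8 hΦ, normalizedTerm_of_lt_eight hω h4 h8 hΦ]
      · have : m = 8 ∨ m = 9 := by omega
        rcases this with rfl | rfl
        · rw [normalizedTerm_eight hω hΦ, normalizedTerm_eight hω hΦ]
        · rw [normalizedTerm_nine hω hΦ, normalizedTerm_nine hω hΦ]
  · have h6 : normalizedTerm μ ω 6 φ q Φ Q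
        = -720 * coupling μ ω Φ * (2 / 3 * (Kt - Et) * chi ω q Φ ^ 2) := by
      rw [normalizedTerm_of_lt_eight hω (by norm_num) (by norm_num) hΦ,
        average_arrangement_of_gt_four (by norm_num), circleMean_invRhoCoeff_two]
      norm_num [Nat.factorial]
    have h7 : normalizedTerm μ ω 7 φ q Φ Q = 0 := by
      rw [normalizedTerm_of_lt_eight hω (by norm_num) (by norm_num) hΦ,
        average_arrangement_of_gt_four (by norm_num), circleMean_invRhoCoeff_odd (by decide),
        mul_zero]
    unfold normalizedHamiltonian
    simp only [Finset.sum_range_succ, Finset.sum_range_zero]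
    rw [hN0, hN 1 (by norm_num) (by norm_num), hN 2 (by norm_num) (by norm_num),
      hN 3 (by norm_num) (by norm_num), normalizedTerm_four hω hΦ, normalizedTerm_five hω hΦ,
      h6, h7, normalizedTerm_eight hω hΦ, ← sigma_sq_eq hω hΦ Q, coupling_eq hμ hω hΦ,
      semiminor_sq hω hΦ]
    unfold b1 b2 b3 b4
    norm_num [Nat.factorial]
    field_simp
    ring
  · have hx := freqRatio_pos hμ hω hΦ
    have h1 : 0 < 4 * Et - Kt := by linarith [Et_lower, Kt_upper]
    have h2 : 0 < 11 * Kt - 14 * Et := by linarith [Et_upper, Kt_lower]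
    unfold b2 b3 b4
    exact ⟨by positivity, by positivity, by positivity⟩
  · rw [b1_eq, mul_eq_zero, mul_eq_zero, sub_eq_zero, sub_eq_zero]
    simp [hlead.ne']
  · rw [b1_eq]
    exact mul_pos hlead (mul_pos_of_neg_of_neg (by linarith)
      (by linarith [ratioMinus_lt_ratioPlus]))
  · rw [b1_eq]
    exact mul_neg_of_pos_of_neg hlead (mul_neg_of_pos_of_neg (by linarith) (by linarith))
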